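/- Let $0<\gamma_1<\gamma_2$ and let $W:\mathbb R\to\mathbb R$ be a Schwartz function. Put $C(p)=\sqrt{\gamma_1^2+\gamma_2^2+2\gamma_1\gamma_2\cos p}$, $G(p)=\gamma_2-\gamma_1+C(p)$, $J(p)=G(2p)^2+4\gamma_1\gamma_2\cos^2p$, $\omega_1(p)=\sqrt{\gamma_1+\gamma_2-C(2p)}$, $$\mathcal A(p)=\frac1{J(p)}\begin{pmatrix}G(2p)^2&2\gamma_1G(2p)\cos p\\2\gamma_2G(2p)\cos p&4\gamma_1\gamma_2\cos^2p\end{pmatrix},\quad c=\sqrt{\frac{2\gamma_1\gamma_2}{\gamma_1+\gamma_2}},\quad q=c\,\frac{\gamma_1^2-\gamma_1\gamma_2+\gamma_2^2}{2(\gamma_1+\gamma_2)^2},$$ $$\tilde V^0(p)=\Big(\sum_{k\in\mathbb Z}W(2k)e^{-2ikp},\ \sum_{k\in\mathbb Z}W(2k+1)e^{-i(2k+1)p}\Big)^T,\qquad I^{ac}(x,t)=\frac1\pi\int_{-\pi/2}^{\pi/2}\mathcal A(p)\tilde V^0(p)e^{\frac i\mu(px+\omega_1(p)t)}\,dp .$$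 For $z\ge0$ let $\tilde V^0_1(z)=\frac12(\tilde V^0(\sqrt z)+\tilde V^0(-\sqrt z))$ and $\tilde V^0_2(z)=\frac1{2\sqrt z}(\tilde V^0(\sqrt z)-\tilde V^0(-\sqrt z))$, with the limit value $\tilde V^0_2(0)=(\tilde V^0)'(0)$; for $z<0$ continue both by $f(z)=3f(0)-3f(-z)+f(-2z)$. Let $\mathrm{Ai}(z)=\frac1\pi\int_0^\infty\cos(zs+s^3/3)\,ds$ (improper integral) be the Airy function. Put $a=(\mu/(qt))^{1/3}$ and $$P_+=\mathcal A(0)\,\mathrm{Re}\Big(\tilde V^0_1\big(-\tfrac{x-ct}{qt}\big)\mathrm{Ai}\big(\tfrac{x-ct}{\mu^{2/3}(qt)^{1/3}}\big)-i\,a\,\tilde V^0_2\big(-\tfrac{x-ct}{qt}\big)\mathrm{Ai}'\big(\tfrac{x-ct}{\mu^{2/3}(qt)^{1/3}}\big)\Big),$$ $$P_-=\mathcal A(0)\,\mathrm{Re}\Big(\tilde V^0_1\big(\tfrac{x+ct}{qt}\big)\mathrm{Ai}\big(-\tfrac{x+ct}{\mu^{2/3}(qt)^{1/3}}\big)+i\,a\,\tilde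 V^0_2\big(\tfrac{x+ct}{qt}\big)\mathrm{Ai}'\big(-\tfrac{x+ct}{\mu^{2/3}(qt)^{1/3}}\big)\Big).$$ Then $\mathrm{Re}\,I^{ac}(x,t)=a\,P_\pm\,(1+O(\mu^{2/3}))$ in the $O(\mu^{2/3})$-vicinity of the front $x=\pm ct$, in the following sense. For all $K>0$ and $t_0>0$ there are $C>0$ and $\mu_0>0$ such that, for each sign, all $0<\mu\le\mu_0$, all $t\ge t_0$, all $x$ with $|x\mp ct|\le K\mu^{2/3}$ and each component $j\in\{1,2\}$, $$\big|\mathrm{Re}\,I^{ac}_j(x,t)-a\,(P_\pm)_j\big|\le C\,\mu^{2/3}\,a ,$$ and, for every $\kappa>0$, if $|(P_\pm)_j|\ge\kappa$ then $\mathrm{Re}\,I^{ac}_j(x,t)=a\,(P_\pm)_j(1+r)$ for some real $r$ with $|r|\le (C/\kappa)\mu^{2/3}$. -/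

import Mathlib

noncomputable section

namespace DiatomicLattice

/-- The Airy function `Ai z = (1/π) ∫₀^∞ cos (z s + s³/3) ds`. The integral converges only
conditionally, so it is taken as the improper integral `lim_{R → ∞} ∫₀^R`. -/
def airyAi (z : ℝ) : ℝ :=
  Filter.limUnder Filter.atTop
    (fun R : ℝ => (1 / Real.pi) * ∫ s in (0 : ℝ)..R, Real.cos (z * s + s ^ 3 / 3))

/-- The derivative `Ai'`. -/
def airyAiDeriv (z : ℝ) : ℝ := deriv airyAi z

/-- `C(p) = √(γ₁² + γ₂² + 2 γ₁ γ₂ cos p)`. -/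
def Cfun (γ₁ γ₂ p : ℝ) : ℝ :=
  Real.sqrt (γ₁ ^ 2 + γ₂ ^ 2 + 2 * γ₁ * γ₂ * Real.cos p)

/-- `G(p) = γ₂ - γ₁ + C(p)`. -/
def Gfun (γ₁ γ₂ p : ℝ) : ℝ := γ₂ - γ₁ + Cfun γ₁ γ₂ p

/-- `J(p) = G(2p)² + 4 γ₁ γ₂ cos² p`. -/
def Jfun (γ₁ γ₂ p : ℝ) : ℝ :=
  Gfun γ₁ γ₂ (2 * p) ^ 2 + 4 * γ₁ * γ₂ * Real.cos p ^ 2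

/-- The acoustic frequency `ω₁(p) = √(γ₁ + γ₂ - C(2p))`. -/
def omega1 (γ₁ γ₂ p : ℝ) : ℝ := Real.sqrt (γ₁ + γ₂ - Cfun γ₁ γ₂ (2 * p))

/-- The matrix `𝒜(p)` of the acoustic mode. -/
def matA (γ₁ γ₂ p : ℝ) : Matrix (Fin 2) (Fin 2) ℝ :=
  (1 / Jfun γ₁ γ₂ p) •
    !![Gfun γ₁ γ₂ (2 * p) ^ 2, 2 * γ₁ * Gfun γ₁ γ₂ (2 * p) * Real.cos p;
       2 * γ₂ * Gfun γ₁ γ₂ (2 * p) * Real.cos p, 4 * γ₁ * γ₂ * Real.cos p ^ 2]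

/-- The front velocity `c`. -/
def cVel (γ₁ γ₂ : ℝ) : ℝ := Real.sqrt (2 * γ₁ * γ₂ / (γ₁ + γ₂))

/-- The dispersion constant `q`. -/
def qDisp (γ₁ γ₂ : ℝ) : ℝ :=
  cVel γ₁ γ₂ * ((γ₁ ^ 2 - γ₁ * γ₂ + γ₂ ^ 2) / (2 * (γ₁ + γ₂) ^ 2))

/-- The vector `Ṽ⁰(p) = (W̃₁(p), W̃₂(p))` of semi-discrete Fourier transforms, over the even and
over the odd sites, of the lattice values `W n` (the case `δ = h / μ = 1`). -/
def tildeV (W : SchwartzMap ℝ ℝ) (p : ℝ) : Fin 2 → ℂ :=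
  ![∑' k : ℤ, (W (2 * (k : ℝ)) : ℂ) * Complex.exp (-Complex.I * p * (2 * (k : ℂ))),
    ∑' k : ℤ, (W (2 * (k : ℝ) + 1) : ℂ) * Complex.exp (-Complex.I * p * (2 * (k : ℂ) + 1))]

/-- The acoustic integral
`I^{ac}(x,t) = (1/π) ∫_{-π/2}^{π/2} 𝒜(p) Ṽ⁰(p) exp((i/μ)(p x + ω₁(p) t)) dp`. -/
def Iac (γ₁ γ₂ : ℝ) (W : SchwartzMap ℝ ℝ) (μ x t : ℝ) : Fin 2 → ℂ := fun j =>
  (1 / (Real.pi : ℂ)) * ∫ p in (-(Real.pi / 2))..(Real.pi / 2),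
    ((matA γ₁ γ₂ p).map Complex.ofReal).mulVec (tildeV W p) j *
      Complex.exp (Complex.I / μ * (p * x + omega1 γ₁ γ₂ p * t))

/-- `Ṽ⁰₁(z) = (Ṽ⁰(√z) + Ṽ⁰(-√z)) / 2`, meant for `z ≥ 0`. -/
def evenPart (W : SchwartzMap ℝ ℝ) (z : ℝ) : Fin 2 → ℂ := fun j =>
  (tildeV W (Real.sqrt z) j + tildeV W (-Real.sqrt z) j) / 2

/-- `Ṽ⁰₂(z) = (Ṽ⁰(√z) - Ṽ⁰(-√z)) / (2 √z)`, meant for `z ≥ 0`; at `z = 0` it takes its limit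
value, the derivative of `Ṽ⁰` at `0`. -/
def oddPart (W : SchwartzMap ℝ ℝ) (z : ℝ) : Fin 2 → ℂ := fun j =>
  if z = 0 then deriv (fun p : ℝ => tildeV W p j) 0
  else (tildeV W (Real.sqrt z) j - tildeV W (-Real.sqrt z) j) / (2 * (Real.sqrt z : ℂ))

/-- The three-point continuation to `z < 0` of a function given for `z ≥ 0`:
`f(z) = 3 f(0) - 3 f(-z) + f(-2z)` for `z < 0`. -/
def threePoint (f : ℝ → Fin 2 → ℂ) (z : ℝ) : Fin 2 → ℂ :=
  if 0 ≤ z then f z else fun j => 3 * f 0 j - 3 * f (-z) j + f (-2 * z) j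

/-- `Ṽ⁰₁` on the whole line. -/
def tildeV1 (W : SchwartzMap ℝ ℝ) : ℝ → Fin 2 → ℂ := threePoint (evenPart W)

/-- `Ṽ⁰₂` on the whole line. -/
def tildeV2 (W : SchwartzMap ℝ ℝ) : ℝ → Fin 2 → ℂ := threePoint (oddPart W)

/-- The factor `(μ / (q t))^{1/3}`. -/
def amp (γ₁ γ₂ μ t : ℝ) : ℝ := (μ / (qDisp γ₁ γ₂ * t)) ^ (1 / 3 : ℝ)

/-- The vector `𝒜(0) Re(Ṽ⁰₁(z) Ai(y) - i (μ/(qt))^{1/3} Ṽ⁰₂(z) Ai'(y))` at the front `x = ct`,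
where `z = -(x - ct)/(qt)` and `y = (x - ct)/(μ^{2/3} (qt)^{1/3})`. -/
def rightProfile (γ₁ γ₂ : ℝ) (W : SchwartzMap ℝ ℝ) (μ x t : ℝ) : Fin 2 → ℝ :=
  let c := cVel γ₁ γ₂
  let q := qDisp γ₁ γ₂
  let z := -((x - c * t) / (q * t))
  let y := (x - c * t) / (μ ^ (2 / 3 : ℝ) * (q * t) ^ (1 / 3 : ℝ))
  (matA γ₁ γ₂ 0).mulVec fun j =>
    (tildeV1 W z j * (airyAi y : ℂ)
      - Complex.I * (amp γ₁ γ₂ μ t : ℂ) * tildeV2 W z j * (airyAiDeriv y : ℂ)).re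

/-- The vector `𝒜(0) Re(Ṽ⁰₁(z) Ai(y) + i (μ/(qt))^{1/3} Ṽ⁰₂(z) Ai'(y))` at the front `x = -ct`,
where `z = (x + ct)/(qt)` and `y = -(x + ct)/(μ^{2/3} (qt)^{1/3})`. -/
def leftProfile (γ₁ γ₂ : ℝ) (W : SchwartzMap ℝ ℝ) (μ x t : ℝ) : Fin 2 → ℝ :=
  let c := cVel γ₁ γ₂
  let q := qDisp γ₁ γ₂
  let z := (x + c * t) / (q * t)
  let y := -((x + c * t) / (μ ^ (2 / 3 : ℝ) * (q * t) ^ (1 / 3 : ℝ)))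
  (matA γ₁ γ₂ 0).mulVec fun j =>
    (tildeV1 W z j * (airyAi y : ℂ)
      + Complex.I * (amp γ₁ γ₂ μ t : ℂ) * tildeV2 W z j * (airyAiDeriv y : ℂ)).re

/-- `value = a * profile * (1 + O(ε))` with constant `C`, where `a > 0` is the order of the leading
term: the error is at most `C ε a`, and wherever `|profile|` is at least `κ > 0` it is a genuine
factor `1 + r` with `|r| ≤ (C / κ) ε`. (No such factor can exist at the zeros of the profile.) -/
def LeadingOrder (C ε a profile value : ℝ) : Prop :=
  |value - a * profile| ≤ C * ε * a ∧
    ∀ κ : ℝ, 0 < κ → κ ≤ |profile| →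
      ∃ r : ℝ, |r| ≤ C / κ * ε ∧ value = a * profile * (1 + r)

end DiatomicLattice

end

/-!
The acoustic frequency is `ω₁ = |Ω|` for an odd smooth function `Ω(p) = c p - q p³ / 3 + O(p⁵)` that
increases on `[-π/2, π/2]`. Near the front `x = c t` the half `p > 0` of the integral has the
phase `p x + Ω t` without stationary points and contributes `O(μ / t)`. The amplitude at `-p` is the
conjugate of the amplitude at `p`, so the half `p < 0` has the same real part as one half of the
integral over the whole interval with the phase `p x - Ω t`, whose stationary points coalesce at the
origin. With `a³ = μ / (q t)` and `y = a (x - c t) / μ` this phase divided by `μ` is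
`(a² y p + ψ(p)) / a³`, where `ψ(p) = p³ / 3 + O(p⁵)`.

Along the segment from `p³ / 3` to `ψ` the integral has the derivative `∫ O(p⁵) e^{i(...)} / a³`,
which is `O(a³)`, because repeated integration by parts makes a factor `p` count as a factor `a` and
the integral itself as another one. Only the terms `F(0) + F'(0) p` of the amplitude contribute
above this order, and they produce `Ai(y)` and `Ai'(y)`. For `|x - c t| ≤ K μ^(2/3)`, replacing
`F(0)` by `Ṽ⁰₁(z)` costs `O(|z|) = O(μ^(2/3))`, and replacing `a F'(0)` by `a Ṽ⁰₂(z)` costs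
`a O(√|z|) = O(μ^(2/3))`, since `a = O(μ^(1/3))`. The reflection `p ↦ -p` exchanges the two fronts.
-/

noncomputable section

open scoped ContDiff Topology ComplexConjugate
open MeasureTheory Filter Set Asymptotics

namespace DiatomicLattice

section Calculus

variable {E : Type*} [NormedAddCommGroup E] [NormedSpace ℝ E]

theorem hasDerivAt_intervalIntegral_of_continuous {F F' : ℝ → ℝ → E} {a b : ℝ}
    (hF : ∀ x, Continuous (F x)) (hF' : Continuous (Function.uncurry F'))
    (hd : ∀ x s, HasDerivAt (fun x => F x s) (F' x s) x) (x₀ : ℝ) :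
    HasDerivAt (fun x => ∫ s in a..b, F x s) (∫ s in a..b, F' x₀ s) x₀ := by
  have hc : IsCompact (Icc (x₀ - 1) (x₀ + 1) ×ˢ uIcc a b) := isCompact_Icc.prod isCompact_uIcc
  obtain ⟨M, hM⟩ := hc.exists_bound_of_continuousOn hF'.continuousOn
  exact (intervalIntegral.hasDerivAt_integral_of_dominated_loc_of_deriv_le
    (bound := fun _ => M) (Icc_mem_nhds (by linarith) (by linarith))
    (.of_forall fun x => (hF x).aestronglyMeasurable) ((hF x₀).intervalIntegrable _ _)
    (hF'.comp (Continuous.prodMk_right x₀)).aestronglyMeasurable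
    (.of_forall fun t ht x hx => hM (x, t) ⟨hx, uIoc_subset_uIcc ht⟩)
    intervalIntegrable_const (.of_forall fun t _ x _ => hd x t)).2

theorem hasDerivAt_integral_pow_smul_comp_mul {f : ℝ → E} (hf : ContDiff ℝ ∞ f) (k : ℕ) (p : ℝ) :
    HasDerivAt (fun p : ℝ => ∫ t in (0 : ℝ)..1, t ^ k • f (t * p))
      (∫ t in (0 : ℝ)..1, t ^ (k + 1) • deriv f (t * p)) p := by
  obtain ⟨hdiff, hderiv⟩ := contDiff_infty_iff_deriv.1 hf
  have hfc := hf.continuous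
  have hdc := hderiv.continuous
  refine hasDerivAt_intervalIntegral_of_continuous (F := fun p t => t ^ k • f (t * p))
    (F' := fun p t => t ^ (k + 1) • deriv f (t * p)) (fun x => by fun_prop)
    (by simp only [Function.uncurry_def]; fun_prop) (fun x t => ?_) p
  have := ((hdiff (t * x)).hasDerivAt.scomp x ((hasDerivAt_id x).const_mul t)).const_smul (t ^ k)
  simpa [smul_smul, pow_succ, Function.comp_def] using! this

theorem contDiff_integral_pow_smul_comp_mul {f : ℝ → E} (hf : ContDiff ℝ ∞ f) (k n : ℕ) :
    ContDiff ℝ n fun p : ℝ => ∫ t in (0 : ℝ)..1, t ^ k • f (t * p) := by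
  induction n generalizing k f with
  | zero =>
    exact contDiff_zero.2 (continuous_iff_continuousAt.2 fun p =>
      (hasDerivAt_integral_pow_smul_comp_mul hf k p).continuousAt)
  | succ n ih =>
    rw [show ((n + 1 : ℕ) : ℕ∞ω) = (n : ℕ∞ω) + 1 from rfl, contDiff_succ_iff_deriv]
    refine ⟨fun p => (hasDerivAt_integral_pow_smul_comp_mul hf k p).differentiableAt, by simp, ?_⟩
    rw [funext fun p => (hasDerivAt_integral_pow_smul_comp_mul hf k p).deriv]
    exact ih (contDiff_infty_iff_deriv.1 hf).2 (k + 1)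

theorem exists_contDiff_eq_add_smul [CompleteSpace E] {f : ℝ → E} (hf : ContDiff ℝ ∞ f) :
    ∃ g : ℝ → E, ContDiff ℝ ∞ g ∧ ∀ p, f p = f 0 + p • g p := by
  obtain ⟨hdiff, hderiv⟩ := contDiff_infty_iff_deriv.1 hf
  have hdc := hderiv.continuous
  refine ⟨fun p => ∫ t in (0 : ℝ)..1, t ^ 0 • deriv f (t * p),
    contDiff_infty.2 (contDiff_integral_pow_smul_comp_mul hderiv 0), fun p => ?_⟩
  have hd (t : ℝ) (_ : t ∈ uIcc (0 : ℝ) 1) :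
      HasDerivAt (fun t : ℝ => f (t * p)) (p • deriv f (t * p)) t := by
    have := (hdiff (t * p)).hasDerivAt.scomp t ((hasDerivAt_id t).mul_const p)
    simpa [Function.comp_def] using! this
  have hftc := intervalIntegral.integral_eq_sub_of_hasDerivAt hd
    ((by fun_prop : Continuous fun t : ℝ => p • deriv f (t * p)).intervalIntegrable _ _)
  rw [intervalIntegral.integral_smul, one_mul, zero_mul] at hftc
  simp only [pow_zero, one_smul, hftc, add_sub_cancel]

theorem exists_contDiff_eq_pow_smul_of_eventually_zero {f : ℝ → E} (hf : ContDiff ℝ ∞ f)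
    (h0 : ∀ᶠ p in 𝓝 0, f p = 0) (k : ℕ) :
    ∃ g : ℝ → E, ContDiff ℝ ∞ g ∧ ∀ p, f p = p ^ k • g p := by
  refine ⟨fun p => (p ^ k)⁻¹ • f p, contDiff_iff_contDiffAt.2 fun p => ?_, fun p => ?_⟩
  all_goals obtain rfl | hp := eq_or_ne p 0
  · refine (contDiffAt_const (c := (0 : E))).congr_of_eventuallyEq ?_
    filter_upwards [h0] with p hp
    rw [hp, smul_zero]
  · exact ((contDiff_id.pow k).contDiffAt.inv (pow_ne_zero k hp)).smul hf.contDiffAt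
  · simp only [h0.self_of_nhds, smul_zero]
  · rw [smul_smul, mul_inv_cancel₀ (pow_ne_zero k hp), one_smul]

end Calculus

/-- A smooth cutoff function on the line, equal to `1` near the origin and compactly supported in
`(-L, L)`. It is complex valued because it multiplies complex amplitudes. -/
structure IsCutoff (L : ℝ) (χ : ℝ → ℂ) : Prop where
  contDiff : ContDiff ℝ ∞ χ
  eventually_eq_one : ∀ᶠ p in 𝓝 0, χ p = 1
  tsupport_subset : tsupport χ ⊆ Ioo (-L) L

theorem exists_isCutoff {L : ℝ} (hL : 0 < L) : ∃ χ : ℝ → ℂ, IsCutoff L χ := by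
  let f : ContDiffBump (0 : ℝ) := ⟨L / 4, L / 2, by linarith, by linarith⟩
  refine ⟨fun p => f p, Complex.ofRealCLM.contDiff.comp f.contDiff,
    f.eventuallyEq_one.mono fun p hp => by simp [hp], ?_⟩
  refine (closure_mono (Function.support_comp_subset Complex.ofReal_zero f)).trans ?_
  rw [← tsupport, f.tsupport_eq, Real.closedBall_eq_Icc]
  exact Icc_subset_Ioo (by simp only [f]; linarith) (by simp only [f]; linarith)

/-! ### Oscillatory integrals with a cubic phase -/

/-- Parameters of the oscillatory integrals: the homotopy parameter `τ` of the phase, the scale `a`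
(the cube root of the small parameter), and the rescaled distance `y` to the front. -/
structure Params where
  τ : ℝ
  a : ℝ
  y : ℝ

/-- The parameters over which all estimates are uniform. Uniform bounds are expressed as
`f =O[𝓟 (admissible Y)] g`. -/
def admissible (Y : ℝ) : Set Params :=
  {θ | θ.τ ∈ Icc (0 : ℝ) 1 ∧ θ.a ∈ Ioc (0 : ℝ) 1 ∧ |θ.y| ≤ Y}

/-- A phase `ψ` on `[-L, L]` with at most a cubic degeneracy, situated at the origin, whose second
derivative is `p * v p`. -/
structure CubicPhase (L d : ℝ) (ψ v : ℝ → ℝ) : Prop where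
  L_pos : 0 < L
  d_pos : 0 < d
  d_le_one : d ≤ 1
  contDiff : ContDiff ℝ ∞ ψ
  contDiff_v : ContDiff ℝ ∞ v
  deriv_deriv : ∀ p, deriv (deriv ψ) p = p * v p
  le_deriv : ∀ p, |p| ≤ L → d * p ^ 2 ≤ deriv ψ p

/-- The segment joining the phase `p ^ 3 / 3` to `ψ`. -/
def phase (ψ : ℝ → ℝ) (τ p : ℝ) : ℝ := (1 - τ) * (p ^ 3 / 3) + τ * ψ p

/-- The derivative of the phase, shifted by `a ^ 2` to stay away from zero. -/
def denom (ψ : ℝ → ℝ) (θ : Params) (p : ℝ) : ℝ :=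
  (1 - θ.τ) * p ^ 2 + θ.τ * deriv ψ p + θ.a ^ 2

/-- The oscillating factor at the scale `a`, with the linear perturbation `a ^ 2 * y * p`. -/
def osc (ψ : ℝ → ℝ) (θ : Params) (p : ℝ) : ℂ :=
  Complex.exp (((θ.a ^ 2 * θ.y * p + phase ψ θ.τ p) / θ.a ^ 3 : ℝ) * Complex.I)

/-- The amplitudes `p ^ k b(p) / denom(p) ^ n`, a class stable under integration by parts. -/
def weight (ψ : ℝ → ℝ) (k n : ℕ) (b : ℝ → ℂ) (θ : Params) (p : ℝ) : ℂ :=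
  (p : ℂ) ^ k * b p / (denom ψ θ p : ℂ) ^ n

/-- The oscillatory integral with amplitude `weight`. -/
def oscInt (L : ℝ) (ψ : ℝ → ℝ) (k n : ℕ) (b : ℝ → ℂ) (θ : Params) : ℂ :=
  ∫ p in (-L)..L, weight ψ k n b θ p * osc ψ θ p

theorem norm_osc (ψ : ℝ → ℝ) (θ : Params) (p : ℝ) : ‖osc ψ θ p‖ = 1 :=
  Complex.norm_exp_ofReal_mul_I _

theorem abs_pow_mul_pow_le {p a : ℝ} (ha : 0 ≤ a) {k j e : ℕ} (hkj : k + j = 2 * e) :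
    |p| ^ k * a ^ j ≤ (p ^ 2 + a ^ 2) ^ e := by
  have hp : |p| ≤ √(p ^ 2 + a ^ 2) := Real.abs_le_sqrt (by linarith [sq_nonneg a])
  have ha' : a ≤ √(p ^ 2 + a ^ 2) := Real.le_sqrt_of_sq_le (by linarith [sq_nonneg p])
  calc |p| ^ k * a ^ j ≤ √(p ^ 2 + a ^ 2) ^ k * √(p ^ 2 + a ^ 2) ^ j := by gcongr
    _ = (p ^ 2 + a ^ 2) ^ e := by rw [← pow_add, hkj, pow_mul, Real.sq_sqrt (by positivity)]

theorem isBigO_zpow_of_le (Y : ℝ) {e e' : ℤ} (he : e' ≤ e) :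
    (fun θ : Params => θ.a ^ e) =O[𝓟 (admissible Y)] fun θ => θ.a ^ e' := by
  refine isBigO_principal.2 ⟨1, fun θ ⟨_, ⟨ha, ha₁⟩, _⟩ => ?_⟩
  rw [one_mul, Real.norm_of_nonneg (by positivity), Real.norm_of_nonneg (by positivity)]
  exact zpow_le_zpow_right_of_le_one₀ ha ha₁ he

theorem isBigO_pow_mul {Y : ℝ} {f : Params → ℂ} {e e' : ℤ} (s : ℕ)
    (hf : f =O[𝓟 (admissible Y)] fun θ => θ.a ^ e) (he : e' ≤ e + s) :
    (fun θ => (θ.a : ℂ) ^ s * f θ) =O[𝓟 (admissible Y)] fun θ => θ.a ^ e' := by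
  have hpow : (fun θ : Params => (θ.a : ℂ) ^ s) =O[𝓟 (admissible Y)] fun θ => θ.a ^ s :=
    isBigO_of_le _ fun θ => by simp
  refine ((hpow.mul hf).congr' .rfl (eventually_principal.2 fun θ hθ => ?_)).trans
    (isBigO_zpow_of_le Y he)
  rw [add_comm, zpow_add₀ hθ.2.1.1.ne', zpow_natCast]

theorem isBigO_bounded_mul {α : Type*} {S : Set α} {c f : α → ℂ} {g : α → ℝ} {M : ℝ}
    (hc : ∀ θ ∈ S, ‖c θ‖ ≤ M) (hf : f =O[𝓟 S] g) : (fun θ => c θ * f θ) =O[𝓟 S] g :=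
  ((isBigO_principal.2 ⟨M, fun θ hθ => by simpa using hc θ hθ⟩ :
    c =O[𝓟 S] fun _ => (1 : ℝ)).mul hf).congr_right fun θ => one_mul _

theorem norm_τ_le {Y : ℝ} {θ : Params} (hθ : θ ∈ admissible Y) : ‖(θ.τ : ℂ)‖ ≤ 1 := by
  simpa [abs_of_nonneg hθ.1.1] using hθ.1.2

theorem norm_one_sub_τ_mul_two_le {Y : ℝ} {θ : Params} (hθ : θ ∈ admissible Y) :
    ‖(1 - θ.τ : ℂ) * 2‖ ≤ 2 := by
  rw [← Complex.ofReal_one, ← Complex.ofReal_sub, norm_mul, Complex.norm_real,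
    Complex.norm_ofNat, Real.norm_of_nonneg (sub_nonneg.2 hθ.1.2)]
  linarith [hθ.1.1]

theorem norm_one_sub_y_le {Y : ℝ} {θ : Params} (hθ : θ ∈ admissible Y) :
    ‖(1 - θ.y : ℂ)‖ ≤ 1 + Y :=
  (norm_sub_le _ _).trans (by simpa using hθ.2.2)

namespace CubicPhase

variable {L d : ℝ} {ψ v : ℝ → ℝ}

theorem differentiable (h : CubicPhase L d ψ v) : Differentiable ℝ ψ :=
  (contDiff_infty_iff_deriv.1 h.contDiff).1

theorem contDiff_deriv (h : CubicPhase L d ψ v) : ContDiff ℝ ∞ (deriv ψ) :=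
  (contDiff_infty_iff_deriv.1 h.contDiff).2

theorem hasDerivAt_deriv (h : CubicPhase L d ψ v) (p : ℝ) : HasDerivAt (deriv ψ) (p * v p) p :=
  h.deriv_deriv p ▸ ((contDiff_infty_iff_deriv.1 h.contDiff_deriv).1 p).hasDerivAt

theorem continuous_osc (h : CubicPhase L d ψ v) (θ : Params) : Continuous (osc ψ θ) := by
  have := h.contDiff.continuous
  unfold osc phase
  fun_prop

theorem continuous_denom (h : CubicPhase L d ψ v) (θ : Params) : Continuous (denom ψ θ) := by
  have := h.contDiff_deriv.continuous
  unfold denom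
  fun_prop

theorem le_denom (h : CubicPhase L d ψ v) {θ : Params} (hτ : θ.τ ∈ Icc (0 : ℝ) 1) {p : ℝ}
    (hp : |p| ≤ L) : d * (p ^ 2 + θ.a ^ 2) ≤ denom ψ θ p := by
  have hcube : (1 - θ.τ) * (d * p ^ 2) ≤ (1 - θ.τ) * p ^ 2 :=
    mul_le_mul_of_nonneg_left (mul_le_of_le_one_left (sq_nonneg p) h.d_le_one)
      (sub_nonneg.2 hτ.2)
  have hψ : θ.τ * (d * p ^ 2) ≤ θ.τ * deriv ψ p :=
    mul_le_mul_of_nonneg_left (h.le_deriv p hp) hτ.1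
  have ha : d * θ.a ^ 2 ≤ θ.a ^ 2 := mul_le_of_le_one_left (sq_nonneg _) h.d_le_one
  unfold denom
  linarith

theorem denom_pos (h : CubicPhase L d ψ v) {θ : Params} (hτ : θ.τ ∈ Icc (0 : ℝ) 1)
    (ha : 0 < θ.a) {p : ℝ} (hp : |p| ≤ L) : 0 < denom ψ θ p :=
  (mul_pos h.d_pos (by positivity)).trans_le (h.le_denom hτ hp)

theorem abs_le_of_mem_uIcc (h : CubicPhase L d ψ v) {p : ℝ} (hp : p ∈ uIcc (-L) L) : |p| ≤ L := by
  rw [uIcc_of_le (by linarith [h.L_pos])] at hp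
  exact abs_le.2 hp

theorem denom_ne_zero (h : CubicPhase L d ψ v) {θ : Params} (hτ : θ.τ ∈ Icc (0 : ℝ) 1)
    (ha : 0 < θ.a) {p : ℝ} (hp : p ∈ uIcc (-L) L) : (denom ψ θ p : ℂ) ≠ 0 :=
  Complex.ofReal_ne_zero.2 (h.denom_pos hτ ha (h.abs_le_of_mem_uIcc hp)).ne'

theorem hasDerivAt_denom (h : CubicPhase L d ψ v) (θ : Params) (p : ℝ) :
    HasDerivAt (denom ψ θ) (p * ((1 - θ.τ) * 2 + θ.τ * v p)) p := by
  have := ((((hasDerivAt_id p).pow 2).const_mul (1 - θ.τ)).add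
    ((h.hasDerivAt_deriv p).const_mul θ.τ)).add_const (θ.a ^ 2)
  refine HasDerivAt.congr_deriv this ?_
  simp only [id, Nat.cast_ofNat]
  ring

theorem hasDerivAt_osc (h : CubicPhase L d ψ v) (θ : Params) (p : ℝ) :
    HasDerivAt (osc ψ θ) (osc ψ θ p *
      (Complex.I / (θ.a : ℂ) ^ 3 * (denom ψ θ p + (θ.a : ℂ) ^ 2 * (θ.y - 1)))) p := by
  have hphase : HasDerivAt (fun p => (θ.a ^ 2 * θ.y * p + phase ψ θ.τ p) / θ.a ^ 3)
      ((denom ψ θ p + θ.a ^ 2 * (θ.y - 1)) / θ.a ^ 3) p := by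
    have := (((hasDerivAt_id p).const_mul (θ.a ^ 2 * θ.y)).add
      (((((hasDerivAt_id p).pow 3).div_const 3).const_mul (1 - θ.τ)).add
        ((h.differentiable p).hasDerivAt.const_mul θ.τ))).div_const (θ.a ^ 3)
    refine HasDerivAt.congr_deriv this ?_
    simp only [denom, id, Nat.cast_ofNat]
    ring
  refine HasDerivAt.congr_deriv (hphase.ofReal_comp.mul_const Complex.I).cexp ?_
  simp only [osc]
  push_cast
  ring

theorem hasDerivAt_weight (h : CubicPhase L d ψ v) {θ : Params} (k n : ℕ) {b : ℝ → ℂ} {p : ℝ}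
    (hb : DifferentiableAt ℝ b p) (hp : (denom ψ θ p : ℂ) ≠ 0) :
    HasDerivAt (weight ψ k n b θ)
      (k * weight ψ (k - 1) n b θ p + weight ψ k n (deriv b) θ p
        - n * ((1 - θ.τ) * 2 * weight ψ (k + 1) (n + 1) b θ p
          + θ.τ * weight ψ (k + 1) (n + 1) (fun p => v p * b p) θ p)) p := by
  have hnum : HasDerivAt (fun p : ℝ => (p : ℂ) ^ k * b p)
      (k * (p : ℂ) ^ (k - 1) * b p + (p : ℂ) ^ k * deriv b p) p := by
    simpa using! ((hasDerivAt_id p).ofReal_comp.pow k).mul hb.hasDerivAt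
  refine HasDerivAt.congr_deriv
    (hnum.div ((h.hasDerivAt_denom θ p).ofReal_comp.pow n) (pow_ne_zero n hp)) ?_
  unfold weight
  cases n with
  | zero => simp [mul_assoc]
  | succ n =>
    push_cast
    field_simp
    ring

theorem continuousOn_weight (h : CubicPhase L d ψ v) {θ : Params} (hτ : θ.τ ∈ Icc (0 : ℝ) 1)
    (ha : 0 < θ.a) (k n : ℕ) {b : ℝ → ℂ} (hb : Continuous b) :
    ContinuousOn (weight ψ k n b θ) (uIcc (-L) L) := by
  have := h.continuous_denom θ
  exact ContinuousOn.div (by fun_prop) (by fun_prop)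
    fun p hp => pow_ne_zero n (h.denom_ne_zero hτ ha hp)

theorem intervalIntegrable (h : CubicPhase L d ψ v) {θ : Params} (hτ : θ.τ ∈ Icc (0 : ℝ) 1)
    (ha : 0 < θ.a) (k n : ℕ) {b : ℝ → ℂ} (hb : Continuous b) :
    IntervalIntegrable (fun p => weight ψ k n b θ p * osc ψ θ p) volume (-L) L :=
  ((h.continuousOn_weight hτ ha k n hb).mul
    (h.continuous_osc θ).continuousOn).intervalIntegrable

/-- Since the oscillating factor has logarithmic derivative `I / a³ * (denom + a² (y - 1))`,
integration by parts trades `denom` for a factor `a²` or `a³`. -/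
theorem integral_denom_mul_osc (h : CubicPhase L d ψ v) {θ : Params} (ha : 0 < θ.a)
    {B B' : ℝ → ℂ} (hB : ∀ p ∈ uIcc (-L) L, HasDerivAt B (B' p) p)
    (hB' : ContinuousOn B' (uIcc (-L) L)) :
    ∫ p in (-L)..L, denom ψ θ p * B p * osc ψ θ p =
      (θ.a : ℂ) ^ 2 * ((1 - θ.y) * ∫ p in (-L)..L, B p * osc ψ θ p)
      - Complex.I * ((θ.a : ℂ) ^ 3 * (B L * osc ψ θ L - B (-L) * osc ψ θ (-L)))
      + Complex.I * ((θ.a : ℂ) ^ 3 * ∫ p in (-L)..L, B' p * osc ψ θ p) := by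
  have hosc := h.continuous_osc θ
  have hden := h.continuous_denom θ
  have hBc : ContinuousOn B (uIcc (-L) L) := fun p hp => (hB p hp).continuousAt.continuousWithinAt
  have hparts := intervalIntegral.integral_mul_deriv_eq_deriv_mul hB
    (fun p _ => h.hasDerivAt_osc θ p) hB'.intervalIntegrable
    (Continuous.intervalIntegrable (by fun_prop) _ _)
  have hsplit : ∫ p in (-L)..L, B p * (osc ψ θ p *
        (Complex.I / (θ.a : ℂ) ^ 3 * (denom ψ θ p + (θ.a : ℂ) ^ 2 * (θ.y - 1)))) =
      Complex.I / (θ.a : ℂ) ^ 3 * (∫ p in (-L)..L, denom ψ θ p * B p * osc ψ θ p)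
      + Complex.I / (θ.a : ℂ) ^ 3 * ((θ.a : ℂ) ^ 2 * (θ.y - 1)) *
        ∫ p in (-L)..L, B p * osc ψ θ p := by
    rw [← intervalIntegral.integral_const_mul, ← intervalIntegral.integral_const_mul,
      ← intervalIntegral.integral_add]
    · exact intervalIntegral.integral_congr fun p _ => by ring
    all_goals exact ContinuousOn.intervalIntegrable (by fun_prop)
  rw [hsplit] at hparts
  have ha' : (θ.a : ℂ) ≠ 0 := Complex.ofReal_ne_zero.2 ha.ne'
  field_simp at hparts
  linear_combination (-Complex.I) * hparts
    + (∫ p in (-L)..L, denom ψ θ p * B p * osc ψ θ p) * Complex.I_sq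
    + ((θ.a : ℂ) ^ 2 * (θ.y - 1) * ∫ p in (-L)..L, B p * osc ψ θ p) * Complex.I_sq

theorem integral_deriv_weight_mul_osc (h : CubicPhase L d ψ v) {θ : Params}
    (hτ : θ.τ ∈ Icc (0 : ℝ) 1) (ha : 0 < θ.a) (k n : ℕ) {b : ℝ → ℂ} (hb : ContDiff ℝ ∞ b) :
    ∫ p in (-L)..L, deriv (weight ψ k n b θ) p * osc ψ θ p =
      k * oscInt L ψ (k - 1) n b θ + oscInt L ψ k n (deriv b) θ
        - n * ((1 - θ.τ) * 2 * oscInt L ψ (k + 1) (n + 1) b θ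
          + θ.τ * oscInt L ψ (k + 1) (n + 1) (fun p => v p * b p) θ) := by
  obtain ⟨hbd, hb'⟩ := contDiff_infty_iff_deriv.1 hb
  have hI (k n : ℕ) {b : ℝ → ℂ} (hb : Continuous b) := h.intervalIntegrable hτ ha k n hb
  have hvb : Continuous fun p => (v p : ℂ) * b p :=
    (Complex.continuous_ofReal.comp h.contDiff_v.continuous).mul hb.continuous
  have i₁ := (hI (k - 1) n hb.continuous).const_mul (k : ℂ)
  have i₂ := hI k n hb'.continuous
  have i₃ := (hI (k + 1) (n + 1) hb.continuous).const_mul ((1 - θ.τ : ℂ) * 2)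
  have i₄ := (hI (k + 1) (n + 1) hvb).const_mul (θ.τ : ℂ)
  simp only [oscInt]
  rw [← intervalIntegral.integral_const_mul (k : ℂ), ← intervalIntegral.integral_add i₁ i₂,
    ← intervalIntegral.integral_const_mul ((1 - θ.τ : ℂ) * 2),
    ← intervalIntegral.integral_const_mul (θ.τ : ℂ),
    ← intervalIntegral.integral_add i₃ i₄, ← intervalIntegral.integral_const_mul (n : ℂ),
    ← intervalIntegral.integral_sub (i₁.add i₂) ((i₃.add i₄).const_mul _)]
  refine intervalIntegral.integral_congr fun p hp => ?_
  simp only [(h.hasDerivAt_weight k n (hbd p) (h.denom_ne_zero hτ ha hp)).deriv]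
  ring

theorem oscInt_eq (h : CubicPhase L d ψ v) {θ : Params} (hτ : θ.τ ∈ Icc (0 : ℝ) 1)
    (ha : 0 < θ.a) (k n : ℕ) {b : ℝ → ℂ} (hb : ContDiff ℝ ∞ b) :
    oscInt L ψ k n b θ =
      (θ.a : ℂ) ^ 2 * ((1 - θ.y) * oscInt L ψ k (n + 1) b θ)
      - Complex.I * ((θ.a : ℂ) ^ 3 * (weight ψ k (n + 1) b θ L * osc ψ θ L
          - weight ψ k (n + 1) b θ (-L) * osc ψ θ (-L)))
      + Complex.I * ((θ.a : ℂ) ^ 3 * (k * oscInt L ψ (k - 1) (n + 1) b θ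
          + oscInt L ψ k (n + 1) (deriv b) θ
          - (n + 1 : ℕ) * ((1 - θ.τ) * 2 * oscInt L ψ (k + 1) (n + 2) b θ
            + θ.τ * oscInt L ψ (k + 1) (n + 2) (fun p => v p * b p) θ))) := by
  obtain ⟨hbd, hb'⟩ := contDiff_infty_iff_deriv.1 hb
  have hcancel : oscInt L ψ k n b θ =
      ∫ p in (-L)..L, denom ψ θ p * weight ψ k (n + 1) b θ p * osc ψ θ p :=
    intervalIntegral.integral_congr fun p hp => by
      have := h.denom_ne_zero hτ ha hp
      simp only [weight]
      field_simp
      ring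
  have hderiv (p : ℝ) (hp : p ∈ uIcc (-L) L) :=
    h.hasDerivAt_weight k (n + 1) (hbd p) (h.denom_ne_zero hτ ha hp)
  have hw (k n : ℕ) {b : ℝ → ℂ} (hb : Continuous b) := h.continuousOn_weight hτ ha k n hb
  have hvb : Continuous fun p => (v p : ℂ) * b p :=
    (Complex.continuous_ofReal.comp h.contDiff_v.continuous).mul hb.continuous
  have hcont : ContinuousOn (deriv (weight ψ k (n + 1) b θ)) (uIcc (-L) L) := by
    refine ContinuousOn.congr ?_ fun p hp => (hderiv p hp).deriv
    exact (((hw _ _ hb.continuous).const_mul _).add (hw _ _ hb'.continuous)).sub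
      (((hw _ _ hb.continuous).const_mul _ |>.add ((hw _ _ hvb).const_mul _)).const_mul _)
  rw [hcancel, h.integral_denom_mul_osc ha
    (fun p hp => (hderiv p hp).differentiableAt.hasDerivAt) hcont,
    h.integral_deriv_weight_mul_osc hτ ha k (n + 1) hb]
  rfl

theorem norm_weight_le (h : CubicPhase L d ψ v) {θ : Params} (hτ : θ.τ ∈ Icc (0 : ℝ) 1)
    (ha : 0 < θ.a) {k n : ℕ} (hkn : k + 2 ≤ 2 * n) {b : ℝ → ℂ} {M p : ℝ} (hM : ‖b p‖ ≤ M)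
    (hp : |p| ≤ L) :
    ‖weight ψ k n b θ p‖ ≤ M / d ^ n * θ.a ^ ((k : ℤ) + 2 - 2 * n) * (θ.a ^ 2 + p ^ 2)⁻¹ := by
  have hd := h.d_pos
  have hM0 : 0 ≤ M := (norm_nonneg _).trans hM
  obtain ⟨e, rfl⟩ : ∃ e, n = e + 1 := ⟨n - 1, by omega⟩
  obtain ⟨j, hj⟩ : ∃ j, k + j = 2 * e := ⟨2 * e - k, by omega⟩
  have hexp : θ.a ^ ((k : ℤ) + 2 - 2 * (e + 1 : ℕ)) = (θ.a ^ j)⁻¹ := by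
    rw [← zpow_natCast, ← zpow_neg]
    congr 1
    omega
  rw [hexp, weight, norm_div, norm_mul, norm_pow, norm_pow, Complex.norm_real, Complex.norm_real,
    Real.norm_eq_abs, Real.norm_of_nonneg (h.denom_pos hτ ha hp).le]
  calc |p| ^ k * ‖b p‖ / denom ψ θ p ^ (e + 1)
      ≤ |p| ^ k * M / (d * (p ^ 2 + θ.a ^ 2)) ^ (e + 1) := by
        gcongr
        exact h.le_denom hτ hp
    _ = M / d ^ (e + 1) * (|p| ^ k * θ.a ^ j) / (p ^ 2 + θ.a ^ 2) ^ e * (θ.a ^ j)⁻¹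
          * (θ.a ^ 2 + p ^ 2)⁻¹ := by
        rw [add_comm (θ.a ^ 2), mul_pow, pow_succ (p ^ 2 + θ.a ^ 2)]
        field_simp
    _ ≤ M / d ^ (e + 1) * (p ^ 2 + θ.a ^ 2) ^ e / (p ^ 2 + θ.a ^ 2) ^ e * (θ.a ^ j)⁻¹
          * (θ.a ^ 2 + p ^ 2)⁻¹ := by
        gcongr
        exact abs_pow_mul_pow_le ha.le hj
    _ = M / d ^ (e + 1) * (θ.a ^ j)⁻¹ * (θ.a ^ 2 + p ^ 2)⁻¹ := by field_simp

theorem isBigO_oscInt_of_le (h : CubicPhase L d ψ v) (Y : ℝ) {k n : ℕ} (hkn : k + 2 ≤ 2 * n)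
    {b : ℝ → ℂ} (hb : Continuous b) :
    oscInt L ψ k n b =O[𝓟 (admissible Y)] fun θ => θ.a ^ ((k : ℤ) + 1 - 2 * n) := by
  have hd := h.d_pos
  obtain ⟨M, hM⟩ := isCompact_Icc.exists_bound_of_continuousOn (s := Icc (-L) L) hb.continuousOn
  have hM0 : 0 ≤ M := (norm_nonneg _).trans (hM 0 (by simp [h.L_pos.le]))
  refine isBigO_principal.2 ⟨M / d ^ n * Real.pi, fun θ ⟨hτ, ⟨ha, _⟩, _⟩ => ?_⟩
  have hlorentz : Continuous fun p : ℝ => (θ.a ^ 2 + p ^ 2)⁻¹ :=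
    Continuous.inv₀ (by fun_prop) fun p => by positivity
  have hle := intervalIntegral.norm_integral_le_of_norm_le (μ := volume)
    (f := fun p => weight ψ k n b θ p * osc ψ θ p) (by linarith [h.L_pos] : -L ≤ L)
    (ae_of_all _ fun p hp => by
      rw [norm_mul, norm_osc, mul_one]
      exact h.norm_weight_le hτ ha hkn (hM p ⟨hp.1.le, hp.2⟩) (abs_le.2 ⟨hp.1.le, hp.2⟩))
    ((hlorentz.const_mul _).intervalIntegrable _ _)
  rw [intervalIntegral.integral_const_mul, integral_inv_sq_add_sq ha.ne'] at hle
  have harctan : Real.arctan (L / θ.a) - Real.arctan (-L / θ.a) ≤ Real.pi := by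
    linarith [Real.arctan_lt_pi_div_two (L / θ.a), Real.neg_pi_div_two_lt_arctan (-L / θ.a)]
  calc ‖oscInt L ψ k n b θ‖
      ≤ M / d ^ n * θ.a ^ ((k : ℤ) + 2 - 2 * n) * (θ.a⁻¹ * Real.pi) := hle.trans (by gcongr)
    _ = M / d ^ n * Real.pi * θ.a ^ ((k : ℤ) + 1 - 2 * n) := by
      rw [show (k : ℤ) + 2 - 2 * n = (k + 1 - 2 * n) + 1 by ring, zpow_add_one₀ ha.ne']
      field_simp
    _ = M / d ^ n * Real.pi * ‖θ.a ^ ((k : ℤ) + 1 - 2 * n)‖ := by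
      rw [Real.norm_of_nonneg (by positivity)]

theorem isBigO_boundary (h : CubicPhase L d ψ v) (Y : ℝ) (k n : ℕ) (b : ℝ → ℂ) :
    (fun θ => weight ψ k n b θ L * osc ψ θ L - weight ψ k n b θ (-L) * osc ψ θ (-L))
      =O[𝓟 (admissible Y)] fun θ => θ.a ^ (0 : ℤ) := by
  have hL := h.L_pos
  have hd := h.d_pos
  have hend {p : ℝ} (hp : |p| = L) : (fun θ => weight ψ k n b θ p * osc ψ θ p)
      =O[𝓟 (admissible Y)] fun θ => θ.a ^ (0 : ℤ) := by
    refine isBigO_principal.2 ⟨L ^ k * ‖b p‖ / (d * L ^ 2) ^ n, fun θ ⟨hτ, ⟨ha, _⟩, _⟩ => ?_⟩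
    rw [norm_mul, norm_osc, weight, norm_div, norm_mul, norm_pow, norm_pow, Complex.norm_real,
      Complex.norm_real, Real.norm_eq_abs, hp, zpow_zero, norm_one,
      Real.norm_of_nonneg (h.denom_pos hτ ha hp.le).le]
    gcongr
    refine le_trans ?_ (h.le_denom hτ hp.le)
    rw [← hp, sq_abs]
    gcongr
    exact le_add_of_nonneg_right (sq_nonneg _)
  exact (hend (abs_of_pos hL)).sub (hend (by rw [abs_neg, abs_of_pos hL]))

theorem isBigO_pow_mul_boundary (h : CubicPhase L d ψ v) (Y : ℝ) (k n : ℕ) {b : ℝ → ℂ} {e : ℤ}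
    (hend : tsupport b ⊆ Ioo (-L) L ∨ e ≤ 3) :
    (fun θ => (θ.a : ℂ) ^ 3 *
      (weight ψ k n b θ L * osc ψ θ L - weight ψ k n b θ (-L) * osc ψ θ (-L)))
      =O[𝓟 (admissible Y)] fun θ => θ.a ^ e := by
  obtain hsupp | he := hend
  · have hb (p : ℝ) (hp : p ∉ Ioo (-L) L) : b p = 0 := image_eq_zero_of_notMem_tsupport
      fun hmem => hp (hsupp hmem)
    simp [weight, hb L (by simp), hb (-L) (by simp), isBigO_zero]
  · exact isBigO_pow_mul 3 (h.isBigO_boundary Y k n b) (by simpa using he)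

/-- Each integration by parts raises `2 n - k` while keeping the order `k + 1 - 2 n`, until the
integrand is absolutely integrable uniformly in `a`. -/
theorem isBigO_oscInt (h : CubicPhase L d ψ v) (Y : ℝ) (m : ℕ) {k n : ℕ} {b : ℝ → ℂ}
    (hkn : k + 2 ≤ 2 * n + 2 * m) (hb : ContDiff ℝ ∞ b)
    (hend : tsupport b ⊆ Ioo (-L) L ∨ k ≤ 2 * n + 2) :
    oscInt L ψ k n b =O[𝓟 (admissible Y)] fun θ => θ.a ^ ((k : ℤ) + 1 - 2 * n) := by
  induction m generalizing k n b with
  | zero => exact h.isBigO_oscInt_of_le Y (by simpa using hkn) hb.continuous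
  | succ m ih =>
    have hvb : ContDiff ℝ ∞ fun p => (v p : ℂ) * b p :=
      (Complex.ofRealCLM.contDiff.comp h.contDiff_v).mul hb
    have hb' := (contDiff_infty_iff_deriv.1 hb).2
    have hshift := ih (k := k) (n := n + 1) (by omega) hb (hend.imp_right (by omega))
    have hpow : (fun θ => k * oscInt L ψ (k - 1) (n + 1) b θ) =O[𝓟 (admissible Y)]
        fun θ => θ.a ^ ((k : ℤ) - 2 * (n + 1)) := by
      cases k with
      | zero => simp [isBigO_zero]
      | succ k =>
        simpa using (ih (k := k) (n := n + 1) (by omega) hb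
          (hend.imp_right (by omega))).const_mul_left ((k + 1 : ℕ) : ℂ)
    have hderiv := (ih (k := k) (n := n + 1) (by omega) hb'
      (hend.imp (tsupport_deriv_subset.trans) (by omega))).trans
        (isBigO_zpow_of_le Y (e' := (k : ℤ) - 2 * (n + 1)) (by push_cast; omega))
    have hdenom {c : ℝ → ℂ} (hc : ContDiff ℝ ∞ c) (hcb : tsupport c ⊆ tsupport b) :=
      (ih (k := k + 1) (n := n + 2) (by omega) hc (hend.imp hcb.trans (by omega))).trans
        (isBigO_zpow_of_le Y (e' := (k : ℤ) - 2 * (n + 1)) (by push_cast; omega))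
    have hsum := (hpow.add hderiv).sub
      (((isBigO_bounded_mul (fun θ => norm_one_sub_τ_mul_two_le) (hdenom hb subset_rfl)).add
        (isBigO_bounded_mul (fun θ => norm_τ_le)
          (hdenom hvb tsupport_mul_subset_right))).const_mul_left ((n + 1 : ℕ) : ℂ))
    refine (((isBigO_pow_mul 2 (isBigO_bounded_mul (fun θ => norm_one_sub_y_le) hshift) ?_).sub
      ((h.isBigO_pow_mul_boundary Y k (n + 1) (hend.imp_right ?_)).const_mul_left Complex.I)).add
      ((isBigO_pow_mul 3 hsum ?_).const_mul_left Complex.I)).congr'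
      (eventually_principal.2 fun θ hθ => (h.oscInt_eq hθ.1 hθ.2.1.1 k n hb).symm) .rfl
    all_goals push_cast; omega

theorem isBigO_oscInt_zero (h : CubicPhase L d ψ v) (Y : ℝ) {k : ℕ} {b : ℝ → ℂ}
    (hb : ContDiff ℝ ∞ b) (hend : tsupport b ⊆ Ioo (-L) L ∨ k ≤ 2) :
    oscInt L ψ k 0 b =O[𝓟 (admissible Y)] fun θ => θ.a ^ (k + 1) := by
  refine (h.isBigO_oscInt Y (k + 1) (k := k) (n := 0) (by omega) hb hend).congr_right fun θ => ?_
  rw [← zpow_natCast]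
  simp

end CubicPhase

/-! ### The Airy function -/

/-- The oscillating factor `exp (i (y s + s³ / 3))` of the Airy integral. -/
def airyExp (y s : ℝ) : ℂ := Complex.exp ((y * s + s ^ 3 / 3 : ℝ) * Complex.I)

/-- The `k`-th moment of `airyExp`, regularized by a compactly supported amplitude `b` at the
scale `1 / a`. For a cutoff `b` its limit as `a → 0` is a derivative of the Airy function. -/
def airyMoment (b : ℝ → ℂ) (k : ℕ) (y a : ℝ) : ℂ :=
  ∫ s : ℝ, (s : ℂ) ^ k * b (a * s) * airyExp y s

theorem continuous_airyExp (y : ℝ) : Continuous (airyExp y) := by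
  unfold airyExp
  fun_prop

theorem airyExp_neg (y s : ℝ) : airyExp y (-s) = conj (airyExp y s) := by
  simp only [airyExp, ← Complex.exp_conj, map_mul, Complex.conj_ofReal, Complex.conj_I]
  congr 1
  push_cast
  ring

theorem hasDerivAt_airyExp_left (y s : ℝ) :
    HasDerivAt (fun y => airyExp y s) (Complex.I * s * airyExp y s) y := by
  have hphase : HasDerivAt (fun y : ℝ => y * s + s ^ 3 / 3) s y := by
    simpa using! ((hasDerivAt_id y).mul_const s).add_const (s ^ 3 / 3)
  exact (hphase.ofReal_comp.mul_const Complex.I).cexp.congr_deriv (by unfold airyExp; ring)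

theorem cubicPhase_cube {L : ℝ} (hL : 0 < L) :
    CubicPhase L 1 (fun p => p ^ 3 / 3) fun _ => 2 := by
  have hderiv : deriv (fun p : ℝ => p ^ 3 / 3) = fun p => p ^ 2 := by
    ext p
    simp
  refine ⟨hL, one_pos, le_rfl, by fun_prop, contDiff_const, fun p => ?_, fun p _ => ?_⟩
  · rw [hderiv]
    simp [mul_comm]
  · rw [hderiv, one_mul]

theorem oscInt_zero_homotopy (L : ℝ) (ψ : ℝ → ℝ) (k : ℕ) (b : ℝ → ℂ) (y : ℝ) {a : ℝ}
    (ha : a ≠ 0) :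
    oscInt L ψ k 0 b ⟨0, a, y⟩ = (a : ℂ) ^ (k + 1) *
      ∫ s in (-(L / a))..(L / a), (s : ℂ) ^ k * b (a * s) * airyExp y s := by
  have hscale := intervalIntegral.smul_integral_comp_mul_left (a := -(L / a)) (b := L / a)
    (E := ℂ) (fun p => weight ψ k 0 b ⟨0, a, y⟩ p * osc ψ ⟨0, a, y⟩ p) a
  rw [mul_neg, mul_div_cancel₀ L ha] at hscale
  rw [oscInt, ← hscale, Complex.real_smul, pow_succ', mul_assoc]
  congr 1
  rw [← intervalIntegral.integral_const_mul]
  refine intervalIntegral.integral_congr fun s _ => ?_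
  have hphase : (a ^ 2 * y * (a * s) + phase ψ 0 (a * s)) / a ^ 3 = y * s + s ^ 3 / 3 := by
    unfold phase
    field_simp
    ring
  simp only [weight, osc, airyExp, hphase]
  push_cast
  ring

section Moments

variable {L : ℝ} {b : ℝ → ℂ}

theorem airyMoment_eq_intervalIntegral (hsupp : tsupport b ⊆ Ioo (-L) L) (k : ℕ) (y : ℝ)
    {a R : ℝ} (ha : 0 < a) (hR : L ≤ a * R) :
    airyMoment b k y a = ∫ s in (-R)..R, (s : ℂ) ^ k * b (a * s) * airyExp y s := by
  refine (intervalIntegral.integral_eq_integral_of_support_subset fun s hs => ?_).symm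
  have hb : b (a * s) ≠ 0 := fun h0 => hs (by simp [h0])
  obtain ⟨hlo, hhi⟩ := hsupp (subset_tsupport b hb)
  exact ⟨by nlinarith, by nlinarith⟩

theorem oscInt_eq_airyMoment (hsupp : tsupport b ⊆ Ioo (-L) L) (ψ : ℝ → ℝ) (k : ℕ) (y : ℝ)
    {a : ℝ} (ha : 0 < a) :
    oscInt L ψ k 0 b ⟨0, a, y⟩ = (a : ℂ) ^ (k + 1) * airyMoment b k y a := by
  rw [oscInt_zero_homotopy L ψ k b y ha.ne',
    airyMoment_eq_intervalIntegral hsupp k y ha (mul_div_cancel₀ L ha.ne').ge]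

theorem exists_norm_airyMoment_le (hL : 0 < L) (hb : ContDiff ℝ ∞ b)
    (hsupp : tsupport b ⊆ Ioo (-L) L) (k : ℕ) (Y : ℝ) :
    ∃ C : ℝ, ∀ a ∈ Ioc (0 : ℝ) 1, ∀ y, |y| ≤ Y → ‖airyMoment b k y a‖ ≤ C := by
  obtain ⟨C, hC⟩ := isBigO_principal.1
    ((cubicPhase_cube hL).isBigO_oscInt_zero Y (k := k) hb (.inl hsupp))
  refine ⟨C, fun a ha y hy => ?_⟩
  have ha' := ha.1
  have hle := hC ⟨0, a, y⟩ ⟨by simp, ha, hy⟩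
  rw [oscInt_eq_airyMoment hsupp _ k y ha', norm_mul, norm_pow, norm_pow, Complex.norm_real,
    Real.norm_of_nonneg ha'.le, mul_comm] at hle
  exact le_of_mul_le_mul_right hle (by positivity)

theorem airyMoment_pow_mul (j k : ℕ) (y a : ℝ) :
    airyMoment (fun p => (p : ℂ) ^ j * b p) k y a = (a : ℂ) ^ j * airyMoment b (k + j) y a := by
  rw [airyMoment, airyMoment, ← integral_const_mul]
  refine integral_congr_ae (.of_forall fun s => ?_)
  push_cast
  ring

theorem airyMoment_mul_affine (hb : Continuous b) (hsupp : tsupport b ⊆ Ioo (-L) L) (c₀ c₁ : ℂ)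
    (y : ℝ) {a : ℝ} (ha : 0 < a) :
    airyMoment (fun p => b p * (c₀ + p * c₁)) 0 y a =
      c₀ * airyMoment b 0 y a + a * c₁ * airyMoment b 1 y a := by
  have hR : L ≤ a * (L / a) := (mul_div_cancel₀ L ha.ne').ge
  have hexp := continuous_airyExp y
  rw [airyMoment_eq_intervalIntegral (tsupport_mul_subset_left.trans hsupp) 0 y ha hR,
    airyMoment_eq_intervalIntegral hsupp 0 y ha hR, airyMoment_eq_intervalIntegral hsupp 1 y ha hR,
    ← intervalIntegral.integral_const_mul, ← intervalIntegral.integral_const_mul,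
    ← intervalIntegral.integral_add (Continuous.intervalIntegrable (by fun_prop) _ _)
      (Continuous.intervalIntegrable (by fun_prop) _ _)]
  refine intervalIntegral.integral_congr fun s _ => ?_
  push_cast
  ring

theorem hasDerivAt_airyMoment (hb : ContDiff ℝ ∞ b) (hsupp : tsupport b ⊆ Ioo (-L) L) (hL : 0 < L)
    (k : ℕ) (y : ℝ) {a : ℝ} (ha : 0 < a) :
    HasDerivAt (airyMoment b k y) (airyMoment (deriv b) (k + 1) y a) a := by
  obtain ⟨hbd, hb'⟩ := contDiff_infty_iff_deriv.1 hb
  have hbc := hb.continuous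
  have hbc' := hb'.continuous
  have hexp := continuous_airyExp y
  have hd (a s : ℝ) : HasDerivAt (fun a : ℝ => (s : ℂ) ^ k * b (a * s) * airyExp y s)
      ((s : ℂ) ^ (k + 1) * deriv b (a * s) * airyExp y s) a := by
    have hcomp : HasDerivAt (fun a : ℝ => b (a * s)) (s * deriv b (a * s)) a := by
      simpa [Function.comp_def] using!
        (hbd (a * s)).hasDerivAt.scomp a ((hasDerivAt_id a).mul_const s)
    exact ((hcomp.const_mul _).mul_const _).congr_deriv (by ring)
  have hR {a' : ℝ} (ha' : a / 2 < a') : L ≤ a' * (2 * L / a) := by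
    rw [mul_div_assoc', le_div_iff₀ ha]
    nlinarith
  rw [airyMoment_eq_intervalIntegral (tsupport_deriv_subset.trans hsupp) (k + 1) y ha
    (hR (half_lt_self ha))]
  refine (hasDerivAt_intervalIntegral_of_continuous (fun a => by fun_prop)
    (by simp only [Function.uncurry_def]; fun_prop) hd a).congr_of_eventuallyEq ?_
  filter_upwards [Ioi_mem_nhds (half_lt_self ha)] with a' ha'
  exact airyMoment_eq_intervalIntegral hsupp k y ((half_pos ha).trans ha') (hR ha')

theorem hasDerivAt_airyMoment_left (hb : Continuous b) (hsupp : tsupport b ⊆ Ioo (-L) L)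
    (k : ℕ) {a : ℝ} (ha : 0 < a) (y : ℝ) :
    HasDerivAt (fun y => airyMoment b k y a) (Complex.I * airyMoment b (k + 1) y a) y := by
  have hR : L ≤ a * (L / a) := (mul_div_cancel₀ L ha.ne').ge
  simp only [airyMoment_eq_intervalIntegral hsupp _ _ ha hR,
    ← intervalIntegral.integral_const_mul]
  refine hasDerivAt_intervalIntegral_of_continuous
    (F' := fun y s => Complex.I * ((s : ℂ) ^ (k + 1) * b (a * s) * airyExp y s)) (fun y => ?_) ?_
    (fun y s => ((hasDerivAt_airyExp_left y s).const_mul _).congr_deriv (by ring)) y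
  · have := continuous_airyExp y
    fun_prop
  · simp only [Function.uncurry_def, airyExp]
    fun_prop

end Moments

theorem tendsto_const_mul_sq_nhdsGT_zero (C : ℝ) :
    Tendsto (fun a : ℝ => C * a ^ 2) (𝓝[>] 0) (𝓝 0) := by
  have hcont : ContinuousAt (fun a : ℝ => C * a ^ 2) 0 := by fun_prop
  simpa [ContinuousAt] using hcont.mono_left nhdsWithin_le_nhds

theorem exists_tendsto_of_norm_sub_le_sq {E : Type*} [NormedAddCommGroup E] [CompleteSpace E]
    {f : ℝ → E} {C : ℝ} (hf : ∀ a ∈ Ioc (0 : ℝ) 1, ∀ a' ∈ Ioc 0 a, ‖f a - f a'‖ ≤ C * a ^ 2) :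
    ∃ l, Tendsto f (𝓝[>] 0) (𝓝 l) := by
  refine cauchy_map_iff_exists_tendsto.1 (Metric.cauchy_iff.2 ⟨inferInstance, fun ε hε => ?_⟩)
  have hsmall := (tendsto_const_mul_sq_nhdsGT_zero C).eventually (gt_mem_nhds (half_pos hε))
  obtain ⟨δ, hδ, hδ'⟩ := (hsmall.and (Ioc_mem_nhdsGT one_pos)).exists
  refine ⟨f '' Ioc 0 δ, image_mem_map (Ioc_mem_nhdsGT hδ'.1), ?_⟩
  rintro _ ⟨a, ha, rfl⟩ _ ⟨a', ha', rfl⟩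
  have h₁ := hf δ hδ' a ha
  have h₂ := hf δ hδ' a' ha'
  rw [← dist_eq_norm] at h₁ h₂
  linarith [dist_triangle_left (f a) (f a') (f δ)]

namespace IsCutoff

variable {L : ℝ} {χ : ℝ → ℂ}

theorem pos (hχ : IsCutoff L χ) : 0 < L :=
  (hχ.tsupport_subset (subset_tsupport χ (by simp [hχ.eventually_eq_one.self_of_nhds]))).2

theorem exists_deriv_eq_mul (hχ : IsCutoff L χ) :
    ∃ g : ℝ → ℂ, ContDiff ℝ ∞ g ∧ tsupport g ⊆ Ioo (-L) L ∧
      deriv χ = fun p : ℝ => (p : ℂ) ^ 1 * g p := by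
  obtain ⟨g, hg, hgχ⟩ := exists_contDiff_eq_add_smul (contDiff_infty_iff_deriv.1 hχ.contDiff).2
  have hzero : deriv χ 0 = 0 := by
    simpa using (EventuallyEq.deriv_eq (f := fun _ => (1 : ℂ)) hχ.eventually_eq_one)
  simp only [hzero, zero_add] at hgχ
  refine ⟨g, hg, ?_, funext fun p => by simpa using hgχ p⟩
  have hsupp : Function.support g ⊆ {0} ∪ tsupport χ := fun p hp => by
    refine or_iff_not_imp_left.2 fun hp₀ => tsupport_deriv_subset (subset_tsupport _ ?_)
    rw [Function.mem_support, hgχ p]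
    exact smul_ne_zero hp₀ hp
  exact (closure_minimal hsupp (isClosed_singleton.union (isClosed_tsupport χ))).trans
    (insert_subset ⟨neg_neg_of_pos hχ.pos, hχ.pos⟩ hχ.tsupport_subset)

theorem exists_one_sub_eq_sq_mul (hχ : IsCutoff L χ) :
    ∃ g : ℝ → ℂ, ContDiff ℝ ∞ g ∧ ∀ p : ℝ, 1 - χ p = (p : ℂ) ^ 2 * g p := by
  obtain ⟨g, hg, hgχ⟩ := exists_contDiff_eq_pow_smul_of_eventually_zero
    (contDiff_const.sub hχ.contDiff : ContDiff ℝ ∞ fun p => 1 - χ p)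
    (hχ.eventually_eq_one.mono fun p hp => sub_eq_zero.2 hp.symm) 2
  exact ⟨g, hg, fun p => by simpa using hgχ p⟩

/-- `χ'` vanishes near the origin, so the derivative of the moment in `a` is `O(a)`. -/
theorem exists_norm_airyMoment_sub_le (hχ : IsCutoff L χ) (k : ℕ) (Y : ℝ) :
    ∃ C : ℝ, ∀ y, |y| ≤ Y → ∀ a ∈ Ioc (0 : ℝ) 1, ∀ a' ∈ Ioc 0 a,
      ‖airyMoment χ k y a - airyMoment χ k y a'‖ ≤ C * a ^ 2 := by
  obtain ⟨g, hg, hsupp, hderiv⟩ := hχ.exists_deriv_eq_mul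
  obtain ⟨C, hC⟩ := exists_norm_airyMoment_le hχ.pos hg hsupp (k + 2) Y
  refine ⟨C, fun y hy a ha a' ha' => ?_⟩
  have hC0 : 0 ≤ C := (norm_nonneg _).trans (hC a ha y hy)
  have hbound (c : ℝ) (hc : c ∈ Icc a' a) : ‖airyMoment (deriv χ) (k + 1) y c‖ ≤ C * a := by
    have hc₀ := ha'.1.trans_le hc.1
    rw [hderiv, airyMoment_pow_mul, pow_one, norm_mul, Complex.norm_real,
      Real.norm_of_nonneg hc₀.le, mul_comm]
    exact mul_le_mul (hC c ⟨hc₀, hc.2.trans ha.2⟩ y hy) hc.2 hc₀.le hC0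
  have hmvt := (convex_Icc a' a).norm_image_sub_le_of_norm_hasDerivWithin_le
    (fun c hc => (hasDerivAt_airyMoment hχ.contDiff hχ.tsupport_subset hχ.pos k y
      (ha'.1.trans_le hc.1)).hasDerivWithinAt) hbound (left_mem_Icc.2 ha'.2) (right_mem_Icc.2 ha'.2)
  calc ‖airyMoment χ k y a - airyMoment χ k y a'‖ ≤ C * a * ‖a - a'‖ := hmvt
    _ ≤ C * a * a := by
      rw [Real.norm_of_nonneg (sub_nonneg.2 ha'.2)]
      exact mul_le_mul_of_nonneg_left (by linarith [ha'.1]) (mul_nonneg hC0 ha.1.le)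
    _ = C * a ^ 2 := by ring

theorem exists_airyMoment_limit (hχ : IsCutoff L χ) (k : ℕ) :
    ∃ Λ : ℝ → ℂ, (∀ y, Tendsto (airyMoment χ k y) (𝓝[>] 0) (𝓝 (Λ y))) ∧
      ∀ Y, ∃ C : ℝ, ∀ y, |y| ≤ Y → ∀ a ∈ Ioc (0 : ℝ) 1,
        ‖airyMoment χ k y a - Λ y‖ ≤ C * a ^ 2 := by
  have hlim (y : ℝ) : ∃ l, Tendsto (airyMoment χ k y) (𝓝[>] 0) (𝓝 l) := by
    obtain ⟨C, hC⟩ := hχ.exists_norm_airyMoment_sub_le k |y|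
    exact exists_tendsto_of_norm_sub_le_sq (hC y le_rfl)
  choose Λ hΛ using hlim
  refine ⟨Λ, hΛ, fun Y => ?_⟩
  obtain ⟨C, hC⟩ := hχ.exists_norm_airyMoment_sub_le k Y
  exact ⟨C, fun y hy a ha => le_of_tendsto ((hΛ y).const_sub _).norm
    (eventually_of_mem (Ioc_mem_nhdsGT ha.1) (hC y hy a ha))⟩

theorem exists_norm_integral_airyExp_sub_le (hχ : IsCutoff L χ) (y : ℝ) :
    ∃ C : ℝ, ∀ a ∈ Ioc (0 : ℝ) 1,
      ‖(∫ s in (-(L / a))..(L / a), airyExp y s) - airyMoment χ 0 y a‖ ≤ C * a ^ 2 := by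
  obtain ⟨g, hg, hχg⟩ := hχ.exists_one_sub_eq_sq_mul
  obtain ⟨C, hC⟩ := isBigO_principal.1
    ((cubicPhase_cube hχ.pos).isBigO_oscInt_zero |y| (k := 2) hg (.inr le_rfl))
  refine ⟨C, fun a ha => ?_⟩
  have ha₀ := ha.1
  have hexp := continuous_airyExp y
  have hχc := hχ.contDiff.continuous
  have := hg.continuous
  have hdiff : (∫ s in (-(L / a))..(L / a), airyExp y s) - airyMoment χ 0 y a =
      (a : ℂ) ^ 2 * ∫ s in (-(L / a))..(L / a), (s : ℂ) ^ 2 * g (a * s) * airyExp y s := by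
    rw [airyMoment_eq_intervalIntegral hχ.tsupport_subset 0 y ha₀ (mul_div_cancel₀ L ha₀.ne').ge,
      ← intervalIntegral.integral_sub (Continuous.intervalIntegrable (by fun_prop) _ _)
        (Continuous.intervalIntegrable (by fun_prop) _ _), ← intervalIntegral.integral_const_mul]
    refine intervalIntegral.integral_congr fun s _ => ?_
    have := hχg (a * s)
    push_cast at this ⊢
    linear_combination airyExp y s * this
  have hle := hC ⟨0, a, y⟩ ⟨by simp, ha, le_rfl⟩
  rw [oscInt_zero_homotopy L _ 2 g y ha₀.ne', norm_mul, norm_pow, norm_pow, Complex.norm_real,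
    Real.norm_of_nonneg ha₀.le, mul_comm] at hle
  rw [hdiff, norm_mul, norm_pow, Complex.norm_real, Real.norm_of_nonneg ha₀.le, mul_comm]
  gcongr
  exact le_of_mul_le_mul_right hle (by positivity)

theorem tendsto_integral_airyExp (hχ : IsCutoff L χ) {y : ℝ} {l : ℂ}
    (hl : Tendsto (airyMoment χ 0 y) (𝓝[>] 0) (𝓝 l)) :
    Tendsto (fun R : ℝ => ∫ s in (-R)..R, airyExp y s) atTop (𝓝 l) := by
  obtain ⟨C, hC⟩ := hχ.exists_norm_integral_airyExp_sub_le y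
  have hsub := squeeze_zero_norm' (eventually_of_mem (Ioc_mem_nhdsGT one_pos) hC)
    (tendsto_const_mul_sq_nhdsGT_zero C)
  have hscale : Tendsto (fun R : ℝ => L / R) atTop (𝓝[>] 0) :=
    tendsto_nhdsWithin_iff.2 ⟨tendsto_const_nhds.div_atTop tendsto_id,
      (eventually_gt_atTop 0).mono fun R hR => div_pos hχ.pos hR⟩
  have hsum := (hsub.add hl).comp hscale
  rw [zero_add] at hsum
  refine hsum.congr fun R => ?_
  simp [div_div_cancel₀ hχ.pos.ne']

end IsCutoff

theorem ofReal_deriv_eq_of_hasDerivAt {f : ℝ → ℝ} {w : ℂ} {x : ℝ}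
    (h : HasDerivAt (fun y => (f y : ℂ)) w x) : ((deriv f x : ℝ) : ℂ) = w := by
  have hre : HasDerivAt f w.re x := by
    simpa [Function.comp_def] using! Complex.reCLM.hasFDerivAt.comp_hasDerivAt x h
  rw [hre.deriv]
  exact hre.ofReal_comp.unique h

theorem integral_airyExp_eq_two_mul_integral_cos (y R : ℝ) :
    ∫ s in (-R)..R, airyExp y s =
      ((2 * ∫ s in (0 : ℝ)..R, Real.cos (y * s + s ^ 3 / 3) : ℝ) : ℂ) := by
  have hint (u w : ℝ) : IntervalIntegrable (airyExp y) volume u w :=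
    (continuous_airyExp y).intervalIntegrable u w
  have hint_neg : IntervalIntegrable (fun s => airyExp y (-s)) volume 0 R :=
    ((continuous_airyExp y).comp continuous_neg).intervalIntegrable 0 R
  have hneg : ∫ s in (-R)..0, airyExp y s = ∫ s in (0 : ℝ)..R, airyExp y (-s) := by
    rw [intervalIntegral.integral_comp_neg, neg_zero]
  have hre (s : ℝ) : airyExp y (-s) + airyExp y s =
      ((2 * Real.cos (y * s + s ^ 3 / 3) : ℝ) : ℂ) := by
    rw [airyExp_neg, add_comm, Complex.add_conj, airyExp, Complex.exp_ofReal_mul_I_re]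
  rw [← intervalIntegral.integral_add_adjacent_intervals (hint (-R) 0) (hint 0 R), hneg,
    ← intervalIntegral.integral_add hint_neg (hint 0 R), ← intervalIntegral.integral_const_mul,
    ← intervalIntegral.integral_ofReal]
  simp only [hre]

theorem ofReal_airyAi_eq {y : ℝ} {l : ℂ}
    (hl : Tendsto (fun R : ℝ => ∫ s in (-R)..R, airyExp y s) atTop (𝓝 l)) :
    (airyAi y : ℂ) = (2 * Real.pi : ℂ)⁻¹ * l := by
  have hlim : Tendsto (fun R : ℝ =>
      (((1 / Real.pi) * ∫ s in (0 : ℝ)..R, Real.cos (y * s + s ^ 3 / 3) : ℝ) : ℂ)) atTop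
      (𝓝 ((2 * Real.pi : ℂ)⁻¹ * l)) := by
    refine (hl.const_mul _).congr fun R => ?_
    rw [integral_airyExp_eq_two_mul_integral_cos]
    push_cast
    field_simp
  have hre := (Complex.continuous_re.tendsto _).comp hlim
  simp only [Function.comp_def, Complex.ofReal_re] at hre
  rw [airyAi, hre.limUnder_eq]
  exact tendsto_nhds_unique ((Complex.continuous_ofReal.tendsto _).comp hre) hlim

namespace IsCutoff

variable {L : ℝ} {χ : ℝ → ℂ}

theorem hasDerivAt_airyMoment_limit (hχ : IsCutoff L χ) {k : ℕ} {Λ Λ' : ℝ → ℂ}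
    (hΛ : ∀ y, Tendsto (airyMoment χ k y) (𝓝[>] 0) (𝓝 (Λ y)))
    (hΛ' : ∀ Y, ∃ C : ℝ, ∀ y, |y| ≤ Y → ∀ a ∈ Ioc (0 : ℝ) 1,
      ‖airyMoment χ (k + 1) y a - Λ' y‖ ≤ C * a ^ 2) (y : ℝ) :
    HasDerivAt Λ (Complex.I * Λ' y) y := by
  obtain ⟨C, hC⟩ := hΛ' (|y| + 1)
  refine hasDerivAt_of_tendstoUniformlyOn (Metric.isOpen_ball (x := y) (ε := 1))
    (f' := fun a y => Complex.I * airyMoment χ (k + 1) y a) (g' := fun y => Complex.I * Λ' y) ?_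
    ?_ (fun w _ => hΛ w) (Metric.mem_ball_self one_pos)
  · refine Metric.tendstoUniformlyOn_iff.2 fun ε hε => ?_
    filter_upwards [(tendsto_const_mul_sq_nhdsGT_zero C).eventually (gt_mem_nhds hε),
      Ioc_mem_nhdsGT one_pos] with a hCa ha w hw
    rw [dist_comm, dist_eq_norm, ← mul_sub, norm_mul, Complex.norm_I, one_mul]
    rw [Metric.mem_ball, Real.dist_eq] at hw
    exact (hC w (by linarith [abs_sub_abs_le_abs_sub w y]) a ha).trans_lt hCa
  · filter_upwards [self_mem_nhdsWithin] with a ha w _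
    exact hasDerivAt_airyMoment_left hχ.contDiff.continuous hχ.tsupport_subset k ha w

theorem exists_norm_airyMoment_sub_airy_le (hχ : IsCutoff L χ) (Y : ℝ) :
    ∃ C : ℝ, ∀ y, |y| ≤ Y → ∀ a ∈ Ioc (0 : ℝ) 1,
      ‖airyMoment χ 0 y a - 2 * Real.pi * airyAi y‖ ≤ C * a ^ 2 ∧
      ‖airyMoment χ 1 y a + 2 * Real.pi * Complex.I * airyAiDeriv y‖ ≤ C * a ^ 2 := by
  obtain ⟨Λ₀, hlim₀, hΛ₀⟩ := hχ.exists_airyMoment_limit 0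
  obtain ⟨Λ₁, -, hΛ₁⟩ := hχ.exists_airyMoment_limit 1
  have hAi (y : ℝ) : (airyAi y : ℂ) = (2 * Real.pi : ℂ)⁻¹ * Λ₀ y :=
    ofReal_airyAi_eq (hχ.tendsto_integral_airyExp (hlim₀ y))
  have hAi' (y : ℝ) : (airyAiDeriv y : ℂ) = (2 * Real.pi : ℂ)⁻¹ * (Complex.I * Λ₁ y) :=
    ofReal_deriv_eq_of_hasDerivAt (by
      simpa only [hAi] using (hχ.hasDerivAt_airyMoment_limit hlim₀ hΛ₁ y).const_mul _)
  obtain ⟨C₀, hC₀⟩ := hΛ₀ Y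
  obtain ⟨C₁, hC₁⟩ := hΛ₁ Y
  refine ⟨max C₀ C₁, fun y hy a ha => ⟨?_, ?_⟩⟩
  · rw [hAi, mul_inv_cancel_left₀ (by simp)]
    exact (hC₀ y hy a ha).trans (by gcongr; exact le_max_left _ _)
  · have hcancel : 2 * Real.pi * Complex.I * airyAiDeriv y = -Λ₁ y := by
      rw [hAi']
      linear_combination Λ₁ y * Complex.I_sq +
        Complex.I ^ 2 * Λ₁ y * mul_inv_cancel₀ (a := (2 * Real.pi : ℂ)) (by simp)
    rw [hcancel, ← sub_eq_add_neg]
    exact (hC₁ y hy a ha).trans (by gcongr; exact le_max_right _ _)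

end IsCutoff

theorem exists_abs_airyAi_le (Y : ℝ) :
    ∃ C : ℝ, ∀ y, |y| ≤ Y → |airyAi y| ≤ C ∧ |airyAiDeriv y| ≤ C := by
  obtain ⟨χ, hχ⟩ := exists_isCutoff one_pos
  obtain ⟨C, hC⟩ := hχ.exists_norm_airyMoment_sub_airy_le Y
  obtain ⟨M₀, hM₀⟩ := exists_norm_airyMoment_le one_pos hχ.contDiff hχ.tsupport_subset 0 Y
  obtain ⟨M₁, hM₁⟩ := exists_norm_airyMoment_le one_pos hχ.contDiff hχ.tsupport_subset 1 Y
  have hone : (1 : ℝ) ∈ Ioc (0 : ℝ) 1 := ⟨one_pos, le_rfl⟩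
  have hle {r B : ℝ} (h : 2 * Real.pi * |r| ≤ B) : |r| ≤ B := by
    nlinarith [abs_nonneg r, Real.pi_gt_three]
  refine ⟨max M₀ M₁ + C, fun y hy => ⟨hle ?_, hle ?_⟩⟩
  · calc 2 * Real.pi * |airyAi y| = ‖(2 * Real.pi * airyAi y : ℂ)‖ := by
          simp [abs_of_pos Real.pi_pos]
      _ ≤ ‖airyMoment χ 0 y 1‖ + ‖airyMoment χ 0 y 1 - 2 * Real.pi * airyAi y‖ :=
        norm_le_norm_add_norm_sub _ _
      _ ≤ max M₀ M₁ + C := by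
        linarith [(hC y hy 1 hone).1, hM₀ 1 hone y hy, le_max_left M₀ M₁]
  · calc 2 * Real.pi * |airyAiDeriv y| = ‖(2 * Real.pi * Complex.I * airyAiDeriv y : ℂ)‖ := by
          simp [abs_of_pos Real.pi_pos]
      _ ≤ ‖airyMoment χ 1 y 1‖ +
          ‖airyMoment χ 1 y 1 + 2 * Real.pi * Complex.I * airyAiDeriv y‖ := by
        rw [add_comm]
        exact norm_le_add_norm_add' _ _
      _ ≤ max M₀ M₁ + C := by
        linarith [(hC y hy 1 hone).2, hM₁ 1 hone y hy, le_max_right M₀ M₁]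

theorem eq_deriv_zero_of_eq_add_smul {E : Type*} [NormedAddCommGroup E] [NormedSpace ℝ E]
    {f g : ℝ → E} (hg : DifferentiableAt ℝ g 0) (h : ∀ p, f p = f 0 + p • g p) :
    g 0 = deriv f 0 := by
  have hderiv := ((hasDerivAt_id (0 : ℝ)).smul hg.hasDerivAt).const_add (f 0)
  simpa using! (hderiv.congr_of_eventuallyEq (.of_forall h)).deriv.symm

theorem IsCutoff.exists_eq_mul_affine_add_sq_mul {L : ℝ} {χ F : ℝ → ℂ} (hχ : IsCutoff L χ)
    (hF : ContDiff ℝ ∞ F) :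
    ∃ g : ℝ → ℂ, ContDiff ℝ ∞ g ∧
      ∀ p : ℝ, F p = χ p * (F 0 + p * deriv F 0) + (p : ℂ) ^ 2 * g p := by
  obtain ⟨g₁, hg₁, hFg₁⟩ := exists_contDiff_eq_add_smul hF
  obtain ⟨g₂, hg₂, hg₁g₂⟩ := exists_contDiff_eq_add_smul hg₁
  obtain ⟨w, hw, hχw⟩ := hχ.exists_one_sub_eq_sq_mul
  have hofReal : ContDiff ℝ ∞ fun p : ℝ => (p : ℂ) := Complex.ofRealCLM.contDiff
  have hslope := eq_deriv_zero_of_eq_add_smul ((contDiff_infty_iff_deriv.1 hg₁).1 0) hFg₁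
  refine ⟨fun p => g₂ p + w p * (F 0 + p * deriv F 0),
    hg₂.add (hw.mul (contDiff_const.add (hofReal.mul contDiff_const))), fun p => ?_⟩
  have hp := hFg₁ p
  rw [hg₁g₂ p, hslope, Complex.real_smul, Complex.real_smul] at hp
  linear_combination hp + (F 0 + p * deriv F 0) * hχw p

namespace CubicPhase

variable {L d : ℝ} {ψ v e : ℝ → ℝ} {b : ℝ → ℂ}

theorem hasDerivAt_osc_homotopy (he : ∀ p, ψ p = p ^ 3 / 3 + p ^ 5 * e p) (τ a y p : ℝ) :
    HasDerivAt (fun τ => osc ψ ⟨τ, a, y⟩ p)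
      (Complex.I / (a : ℂ) ^ 3 * ((p : ℂ) ^ 5 * e p) * osc ψ ⟨τ, a, y⟩ p) τ := by
  have hphase : HasDerivAt (fun τ => (a ^ 2 * y * p + phase ψ τ p) / a ^ 3)
      (p ^ 5 * e p / a ^ 3) τ := by
    refine ((((((hasDerivAt_id τ).const_sub 1).mul_const (p ^ 3 / 3)).add
      ((hasDerivAt_id τ).mul_const (ψ p))).const_add (a ^ 2 * y * p)).div_const
      (a ^ 3)).congr_deriv ?_
    rw [he p]
    ring
  refine (hphase.ofReal_comp.mul_const Complex.I).cexp.congr_deriv ?_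
  simp only [osc]
  push_cast
  ring

theorem hasDerivAt_oscInt_homotopy (hψ : Continuous ψ)
    (he : ∀ p, ψ p = p ^ 3 / 3 + p ^ 5 * e p) (hec : Continuous e) (hb : Continuous b)
    (τ a y : ℝ) :
    HasDerivAt (fun τ => oscInt L ψ 0 0 b ⟨τ, a, y⟩)
      (Complex.I / (a : ℂ) ^ 3 * oscInt L ψ 5 0 (fun p => b p * e p) ⟨τ, a, y⟩) τ := by
  simp only [oscInt, weight, pow_zero, div_one, ← intervalIntegral.integral_const_mul]
  refine hasDerivAt_intervalIntegral_of_continuous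
    (F' := fun τ p => Complex.I / (a : ℂ) ^ 3 *
      ((p : ℂ) ^ 5 * (b p * e p) * osc ψ ⟨τ, a, y⟩ p))
    (fun τ => ?_) ?_
    (fun τ p => ((hasDerivAt_osc_homotopy he τ a y p).const_mul _).congr_deriv ?_) τ
  · simp only [osc, phase]
    fun_prop
  · simp only [Function.uncurry_def, osc, phase]
    fun_prop
  · ring

theorem exists_norm_oscInt_homotopy_sub_le (h : CubicPhase L d ψ v) (hec : ContDiff ℝ ∞ e)
    (he : ∀ p, ψ p = p ^ 3 / 3 + p ^ 5 * e p) (hb : ContDiff ℝ ∞ b)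
    (hsupp : tsupport b ⊆ Ioo (-L) L) (Y : ℝ) :
    ∃ C : ℝ, ∀ a ∈ Ioc (0 : ℝ) 1, ∀ y, |y| ≤ Y →
      ‖oscInt L ψ 0 0 b ⟨1, a, y⟩ - oscInt L ψ 0 0 b ⟨0, a, y⟩‖ ≤ C * a ^ 3 := by
  obtain ⟨C, hC⟩ := isBigO_principal.1 (h.isBigO_oscInt_zero Y (k := 5)
    (hb.mul (Complex.ofRealCLM.contDiff.comp hec))
    (.inl (tsupport_mul_subset_left.trans hsupp)))
  refine ⟨C, fun a ha y hy => ?_⟩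
  have hbound (τ : ℝ) (hτ : τ ∈ Icc (0 : ℝ) 1) :
      ‖Complex.I / (a : ℂ) ^ 3 * oscInt L ψ 5 0 (fun p => b p * e p) ⟨τ, a, y⟩‖ ≤ C * a ^ 3 := by
    have hle := hC ⟨τ, a, y⟩ ⟨hτ, ha, hy⟩
    rw [norm_pow, Real.norm_of_nonneg ha.1.le] at hle
    rw [norm_mul, norm_div, Complex.norm_I, norm_pow, Complex.norm_real,
      Real.norm_of_nonneg ha.1.le, one_div, inv_mul_le_iff₀ (pow_pos ha.1 3)]
    exact hle.trans_eq (by ring)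
  simpa using (convex_Icc (0 : ℝ) 1).norm_image_sub_le_of_norm_hasDerivWithin_le
    (fun τ _ => (hasDerivAt_oscInt_homotopy h.contDiff.continuous he hec.continuous
      hb.continuous τ a y).hasDerivWithinAt) hbound (left_mem_Icc.2 zero_le_one)
    (right_mem_Icc.2 zero_le_one)

theorem exists_norm_oscInt_cutoff_affine_sub_airy_le {χ : ℝ → ℂ} (hχ : IsCutoff L χ)
    (ψ : ℝ → ℝ) (c₀ c₁ : ℂ) (Y : ℝ) :
    ∃ C : ℝ, ∀ a ∈ Ioc (0 : ℝ) 1, ∀ y, |y| ≤ Y →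
      ‖oscInt L ψ 0 0 (fun p => χ p * (c₀ + p * c₁)) ⟨0, a, y⟩ -
        2 * Real.pi * (a * c₀ * airyAi y - Complex.I * a ^ 2 * c₁ * airyAiDeriv y)‖ ≤
        C * a ^ 3 := by
  obtain ⟨C, hC⟩ := hχ.exists_norm_airyMoment_sub_airy_le Y
  refine ⟨(‖c₀‖ + ‖c₁‖) * C, fun a ha y hy => ?_⟩
  obtain ⟨ha₀, ha₁⟩ := ha
  obtain ⟨h₀, h₁⟩ := hC y hy a ⟨ha₀, ha₁⟩
  rw [oscInt_eq_airyMoment (tsupport_mul_subset_left.trans hχ.tsupport_subset) ψ 0 y ha₀,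
    airyMoment_mul_affine hχ.contDiff.continuous hχ.tsupport_subset c₀ c₁ y ha₀]
  calc ‖(a : ℂ) ^ (0 + 1) * (c₀ * airyMoment χ 0 y a + a * c₁ * airyMoment χ 1 y a) -
        2 * Real.pi * (a * c₀ * airyAi y - Complex.I * a ^ 2 * c₁ * airyAiDeriv y)‖
      = ‖a * (c₀ * (airyMoment χ 0 y a - 2 * Real.pi * airyAi y) +
          a * (c₁ * (airyMoment χ 1 y a + 2 * Real.pi * Complex.I * airyAiDeriv y)))‖ := by
        congr 1
        ring
    _ ≤ a * (‖c₀‖ * (C * a ^ 2) + 1 * (‖c₁‖ * (C * a ^ 2))) := by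
        rw [norm_mul, Complex.norm_real, Real.norm_of_nonneg ha₀.le]
        refine mul_le_mul_of_nonneg_left ((norm_add_le _ _).trans ?_) ha₀.le
        simp only [norm_mul, Complex.norm_real, Real.norm_of_nonneg ha₀.le]
        gcongr
    _ = (‖c₀‖ + ‖c₁‖) * C * a ^ 3 := by ring

/-- The cubic part of the phase and the first two Taylor coefficients of the amplitude produce the
Airy terms: the part of the amplitude of order `p ^ 2` and the homotopy of the phase, whose
derivative carries `p ^ 5 / a ^ 3`, both contribute `O(a ^ 3)`. -/
theorem exists_norm_oscInt_sub_airy_le (h : CubicPhase L d ψ v) (hec : ContDiff ℝ ∞ e)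
    (he : ∀ p, ψ p = p ^ 3 / 3 + p ^ 5 * e p) {F : ℝ → ℂ} (hF : ContDiff ℝ ∞ F) (Y : ℝ) :
    ∃ C : ℝ, ∀ a ∈ Ioc (0 : ℝ) 1, ∀ y, |y| ≤ Y →
      ‖oscInt L ψ 0 0 F ⟨1, a, y⟩ - 2 * Real.pi *
        (a * F 0 * airyAi y - Complex.I * a ^ 2 * deriv F 0 * airyAiDeriv y)‖ ≤ C * a ^ 3 := by
  obtain ⟨χ, hχ⟩ := exists_isCutoff h.L_pos
  obtain ⟨g, hg, hFg⟩ := hχ.exists_eq_mul_affine_add_sq_mul hF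
  have hb : ContDiff ℝ ∞ fun p : ℝ => χ p * (F 0 + p * deriv F 0) :=
    hχ.contDiff.mul (contDiff_const.add (Complex.ofRealCLM.contDiff.mul contDiff_const))
  obtain ⟨C₁, hC₁⟩ := isBigO_principal.1 (h.isBigO_oscInt_zero Y (k := 2) hg (.inr le_rfl))
  obtain ⟨C₂, hC₂⟩ := h.exists_norm_oscInt_homotopy_sub_le hec he hb
    (tsupport_mul_subset_left.trans hχ.tsupport_subset) Y
  obtain ⟨C₃, hC₃⟩ := exists_norm_oscInt_cutoff_affine_sub_airy_le hχ ψ (F 0) (deriv F 0) Y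
  refine ⟨C₁ + C₂ + C₃, fun a ha y hy => ?_⟩
  have hsplit : oscInt L ψ 0 0 F ⟨1, a, y⟩ = oscInt L ψ 2 0 g ⟨1, a, y⟩ +
      oscInt L ψ 0 0 (fun p => χ p * (F 0 + p * deriv F 0)) ⟨1, a, y⟩ := by
    have hτ : (1 : ℝ) ∈ Icc (0 : ℝ) 1 := right_mem_Icc.2 zero_le_one
    unfold oscInt
    rw [← intervalIntegral.integral_add (h.intervalIntegrable hτ ha.1 2 0 hg.continuous)
      (h.intervalIntegrable hτ ha.1 0 0 hb.continuous)]
    refine intervalIntegral.integral_congr fun p _ => ?_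
    simp only [weight, hFg p]
    ring
  have hrem := hC₁ ⟨1, a, y⟩ ⟨by simp, ha, hy⟩
  rw [norm_pow, Real.norm_of_nonneg ha.1.le] at hrem
  rw [hsplit, add_sub_assoc]
  refine (norm_add_le_of_le hrem ((norm_sub_le_norm_sub_add_norm_sub _ _ _).trans
    (add_le_add (hC₂ a ha y hy) (hC₃ a ha y hy)))).trans_eq (by ring)

end CubicPhase

/-! ### The acoustic dispersion relation -/

theorem eq_of_pow_mul_eq {f g : ℝ → ℝ} (n : ℕ) (hf : Continuous f) (hg : Continuous g)
    (h : ∀ p, p ^ n * f p = p ^ n * g p) : f = g :=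
  Continuous.ext_on (dense_compl_singleton (0 : ℝ)) hf hg fun p hp =>
    mul_left_cancel₀ (pow_ne_zero n hp) (h p)

theorem exists_even_eq_mul_of_odd {f : ℝ → ℝ} (hf : ContDiff ℝ ∞ f) (hodd : f.Odd) :
    ∃ g : ℝ → ℝ, ContDiff ℝ ∞ g ∧ g.Even ∧ ∀ p, f p = p * g p := by
  obtain ⟨g, hg, hfg⟩ := exists_contDiff_eq_add_smul hf
  simp only [hodd.map_zero, smul_eq_mul, zero_add] at hfg
  have hcont := hg.continuous
  refine ⟨g, hg, congrFun (eq_of_pow_mul_eq 1 (f := fun p => g (-p)) (by fun_prop) hcont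
    fun p => ?_), hfg⟩
  linear_combination hfg p + hfg (-p) - hodd p

theorem exists_even_eq_add_sq_mul {f : ℝ → ℝ} (hf : ContDiff ℝ ∞ f) (heven : f.Even) :
    ∃ g : ℝ → ℝ, ContDiff ℝ ∞ g ∧ g.Even ∧ ∀ p, f p = f 0 + p ^ 2 * g p := by
  obtain ⟨k, hk, hfk⟩ := exists_contDiff_eq_add_smul hf
  simp only [smul_eq_mul] at hfk
  have hcont := hk.continuous
  have hkodd : k.Odd := congrFun (eq_of_pow_mul_eq 1 (f := fun p => k (-p)) (g := fun p => -k p)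
    (by fun_prop) (by fun_prop) fun p => by linear_combination hfk (-p) - hfk p - heven p)
  obtain ⟨g, hg, hgeven, hkg⟩ := exists_even_eq_mul_of_odd hk hkodd
  exact ⟨g, hg, hgeven, fun p => by rw [hfk p, hkg p]; ring⟩

theorem exists_even_eq_cube_mul {f : ℝ → ℝ} (hf : ContDiff ℝ ∞ f) (hodd : f.Odd)
    (hderiv : deriv f 0 = 0) :
    ∃ g : ℝ → ℝ, ContDiff ℝ ∞ g ∧ g.Even ∧ ∀ p, f p = p ^ 3 * g p := by
  obtain ⟨k, hk, hkeven, hfk⟩ := exists_even_eq_mul_of_odd hf hodd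
  obtain ⟨g, hg, hgeven, hkg⟩ := exists_even_eq_add_sq_mul hk hkeven
  have hk0 : k 0 = 0 := (eq_deriv_zero_of_eq_add_smul (f := f)
    ((contDiff_infty_iff_deriv.1 hk).1 0) fun p => by
      rw [hodd.map_zero, zero_add, smul_eq_mul, hfk p]).trans hderiv
  exact ⟨g, hg, hgeven, fun p => by rw [hfk p, hkg p, hk0]; ring⟩

theorem exists_deriv_deriv_eq_mul {f g : ℝ → ℝ} (hg : ContDiff ℝ ∞ g)
    (hfg : ∀ p, f p = p ^ 3 * g p) :
    ∃ v : ℝ → ℝ, ContDiff ℝ ∞ v ∧ v 0 = 6 * g 0 ∧ ∀ p, deriv (deriv f) p = p * v p := by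
  have hg' := contDiff_infty_iff_deriv.1 hg
  have hg'' := contDiff_infty_iff_deriv.1 hg'.2
  have hderiv : deriv f = fun p => 3 * p ^ 2 * g p + p ^ 3 * deriv g p := by
    ext p
    rw [funext hfg]
    refine (((hasDerivAt_pow 3 p).fun_mul (hg'.1 p).hasDerivAt).congr_deriv ?_).deriv
    norm_num
  refine ⟨fun p => 6 * g p + 6 * p * deriv g p + p ^ 2 * deriv (deriv g) p, ?_, by simp,
    fun p => ?_⟩
  · have := hg'.2
    have := hg''.2
    fun_prop
  · rw [hderiv]
    refine (((((hasDerivAt_pow 2 p).const_mul 3).fun_mul (hg'.1 p).hasDerivAt).fun_add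
      ((hasDerivAt_pow 3 p).fun_mul (hg''.1 p).hasDerivAt)).congr_deriv ?_).deriv
    norm_num
    ring

theorem exists_sin_eq_sub_cube_mul :
    ∃ u : ℝ → ℝ, Continuous u ∧ u 0 = 1 / 6 ∧ ∀ p, Real.sin p = p - p ^ 3 * u p := by
  have hderiv : deriv (fun p => p - Real.sin p) = fun p => 1 - Real.cos p :=
    funext fun p => ((hasDerivAt_id p).sub (Real.hasDerivAt_sin p)).deriv
  have hderiv₂ : deriv (fun p => 1 - Real.cos p) = Real.sin := by
    ext p
    simp
  obtain ⟨u, hu, -, hsin⟩ := exists_even_eq_cube_mul (f := fun p => p - Real.sin p)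
    (contDiff_id.sub Real.contDiff_sin) (fun p => by simp only [Real.sin_neg]; ring)
    (by simp)
  obtain ⟨v, hv, hv0, hsinv⟩ := exists_deriv_deriv_eq_mul hu hsin
  rw [hderiv, hderiv₂] at hsinv
  have hv1 : v 0 = 1 := by
    rw [eq_deriv_zero_of_eq_add_smul ((contDiff_infty_iff_deriv.1 hv).1 0) (f := Real.sin)
      fun p => by rw [Real.sin_zero, zero_add, smul_eq_mul, hsinv], Real.deriv_sin, Real.cos_zero]
  exact ⟨u, hu.continuous, by linarith, fun p => by linarith [hsin p]⟩

/-- The functions `radical p` and `radical (-p)` are the square roots of the two factors of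
`C(2p) ^ 2 = (γ₁ + γ₂) ^ 2 - 4 γ₁ γ₂ sin ^ 2 p`. -/
def radical (γ₁ γ₂ p : ℝ) : ℝ :=
  Real.sqrt (γ₁ + γ₂ + 2 * Real.sqrt (γ₁ * γ₂) * Real.sin p)

/-- The odd smooth branch of the acoustic frequency: `ω₁ = |dispersion|`. -/
def dispersion (γ₁ γ₂ p : ℝ) : ℝ :=
  (radical γ₁ γ₂ p - radical γ₁ γ₂ (-p)) / Real.sqrt 2

/-- The deviation of the acoustic branch from the linear one, normalized to `p ^ 3 / 3 + O(p ^ 5)`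
at the origin. -/
def frontPhase (γ₁ γ₂ p : ℝ) : ℝ := (cVel γ₁ γ₂ * p - dispersion γ₁ γ₂ p) / qDisp γ₁ γ₂

section Dispersion

variable {γ₁ γ₂ : ℝ}

theorem two_mul_sqrt_mul_lt_add (hγ₁ : 0 < γ₁) (hγ : γ₁ < γ₂) :
    2 * Real.sqrt (γ₁ * γ₂) < γ₁ + γ₂ := by
  have hsq := Real.sq_sqrt (mul_pos hγ₁ (hγ₁.trans hγ)).le
  nlinarith [Real.sqrt_nonneg (γ₁ * γ₂), sq_pos_of_pos (sub_pos.2 hγ)]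

theorem radicand_pos (hγ₁ : 0 < γ₁) (hγ : γ₁ < γ₂) (p : ℝ) :
    0 < γ₁ + γ₂ + 2 * Real.sqrt (γ₁ * γ₂) * Real.sin p := by
  nlinarith [two_mul_sqrt_mul_lt_add hγ₁ hγ, Real.sqrt_nonneg (γ₁ * γ₂), Real.neg_one_le_sin p]

theorem radical_pos (hγ₁ : 0 < γ₁) (hγ : γ₁ < γ₂) (p : ℝ) : 0 < radical γ₁ γ₂ p :=
  Real.sqrt_pos.2 (radicand_pos hγ₁ hγ p)

theorem radical_sq (hγ₁ : 0 < γ₁) (hγ : γ₁ < γ₂) (p : ℝ) :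
    radical γ₁ γ₂ p ^ 2 = γ₁ + γ₂ + 2 * Real.sqrt (γ₁ * γ₂) * Real.sin p :=
  Real.sq_sqrt (radicand_pos hγ₁ hγ p).le

theorem contDiff_radical (hγ₁ : 0 < γ₁) (hγ : γ₁ < γ₂) : ContDiff ℝ ∞ (radical γ₁ γ₂) :=
  (contDiff_const.add (contDiff_const.mul Real.contDiff_sin)).sqrt
    fun p => (radicand_pos hγ₁ hγ p).ne'

theorem hasDerivAt_radical (hγ₁ : 0 < γ₁) (hγ : γ₁ < γ₂) (p : ℝ) :
    HasDerivAt (radical γ₁ γ₂) (Real.sqrt (γ₁ * γ₂) * Real.cos p / radical γ₁ γ₂ p) p := by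
  refine ((((Real.hasDerivAt_sin p).const_mul (2 * Real.sqrt (γ₁ * γ₂))).const_add
    (γ₁ + γ₂)).sqrt (radicand_pos hγ₁ hγ p).ne').congr_deriv ?_
  rw [mul_assoc, mul_div_mul_left _ _ two_ne_zero]
  rfl

theorem radical_mul_radical_neg_sq (hγ₁ : 0 < γ₁) (hγ : γ₁ < γ₂) (p : ℝ) :
    (radical γ₁ γ₂ p * radical γ₁ γ₂ (-p)) ^ 2 =
      (γ₁ + γ₂) ^ 2 - 4 * (γ₁ * γ₂) * Real.sin p ^ 2 := by
  rw [mul_pow, radical_sq hγ₁ hγ, radical_sq hγ₁ hγ, Real.sin_neg]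
  linear_combination -4 * Real.sin p ^ 2 * Real.sq_sqrt (mul_pos hγ₁ (hγ₁.trans hγ)).le

theorem Cfun_radicand_pos (hγ₁ : 0 < γ₁) (hγ : γ₁ < γ₂) (p : ℝ) :
    0 < γ₁ ^ 2 + γ₂ ^ 2 + 2 * γ₁ * γ₂ * Real.cos p := by
  nlinarith [mul_pos hγ₁ (hγ₁.trans hγ), sq_pos_of_pos (sub_pos.2 hγ), Real.neg_one_le_cos p]

theorem Cfun_two_mul (hγ₁ : 0 < γ₁) (hγ : γ₁ < γ₂) (p : ℝ) :
    Cfun γ₁ γ₂ (2 * p) = radical γ₁ γ₂ p * radical γ₁ γ₂ (-p) := by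
  rw [Cfun, Real.sqrt_eq_iff_eq_sq (Cfun_radicand_pos hγ₁ hγ _).le
    (mul_pos (radical_pos hγ₁ hγ p) (radical_pos hγ₁ hγ (-p))).le,
    radical_mul_radical_neg_sq hγ₁ hγ, Real.cos_two_mul]
  linear_combination (4 * γ₁ * γ₂) * Real.sin_sq_add_cos_sq p

theorem contDiff_dispersion (hγ₁ : 0 < γ₁) (hγ : γ₁ < γ₂) : ContDiff ℝ ∞ (dispersion γ₁ γ₂) := by
  have hradical := contDiff_radical hγ₁ hγ
  unfold dispersion
  fun_prop

theorem dispersion_odd : (dispersion γ₁ γ₂).Odd := fun p => by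
  simp only [dispersion, neg_neg]
  ring

theorem dispersion_sq (hγ₁ : 0 < γ₁) (hγ : γ₁ < γ₂) (p : ℝ) :
    dispersion γ₁ γ₂ p ^ 2 = γ₁ + γ₂ - Cfun γ₁ γ₂ (2 * p) := by
  have hneg := radical_sq hγ₁ hγ (-p)
  rw [Real.sin_neg] at hneg
  rw [Cfun_two_mul hγ₁ hγ, dispersion, div_pow, Real.sq_sqrt zero_le_two]
  linear_combination (radical_sq hγ₁ hγ p + hneg) / 2

theorem dispersion_quartic (hγ₁ : 0 < γ₁) (hγ : γ₁ < γ₂) (p : ℝ) :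
    2 * (γ₁ + γ₂) * dispersion γ₁ γ₂ p ^ 2 - dispersion γ₁ γ₂ p ^ 4 =
      4 * (γ₁ * γ₂) * Real.sin p ^ 2 := by
  have hC := radical_mul_radical_neg_sq hγ₁ hγ p
  rw [← Cfun_two_mul hγ₁ hγ] at hC
  have hsq := dispersion_sq hγ₁ hγ p
  linear_combination (γ₁ + γ₂ - dispersion γ₁ γ₂ p ^ 2 + Cfun γ₁ γ₂ (2 * p)) * hsq - hC

theorem omega1_eq_abs_dispersion (hγ₁ : 0 < γ₁) (hγ : γ₁ < γ₂) (p : ℝ) :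
    omega1 γ₁ γ₂ p = |dispersion γ₁ γ₂ p| := by
  rw [omega1, ← dispersion_sq hγ₁ hγ, Real.sqrt_sq_eq_abs]

theorem dispersion_nonneg {p : ℝ} (hp : p ∈ Icc 0 Real.pi) : 0 ≤ dispersion γ₁ γ₂ p := by
  have hsin := Real.sin_nonneg_of_mem_Icc hp
  refine div_nonneg (sub_nonneg.2 (Real.sqrt_le_sqrt ?_)) (Real.sqrt_nonneg _)
  rw [Real.sin_neg]
  gcongr
  linarith

theorem omega1_of_nonneg (hγ₁ : 0 < γ₁) (hγ : γ₁ < γ₂) {p : ℝ} (hp : p ∈ Icc 0 Real.pi) :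
    omega1 γ₁ γ₂ p = dispersion γ₁ γ₂ p := by
  rw [omega1_eq_abs_dispersion hγ₁ hγ, abs_of_nonneg (dispersion_nonneg hp)]

theorem omega1_of_nonpos (hγ₁ : 0 < γ₁) (hγ : γ₁ < γ₂) {p : ℝ} (hp : p ∈ Icc (-Real.pi) 0) :
    omega1 γ₁ γ₂ p = -dispersion γ₁ γ₂ p := by
  rw [omega1_eq_abs_dispersion hγ₁ hγ, ← abs_neg, ← dispersion_odd,
    abs_of_nonneg (dispersion_nonneg ⟨by linarith [hp.2], by linarith [hp.1]⟩)]

theorem hasDerivAt_dispersion (hγ₁ : 0 < γ₁) (hγ : γ₁ < γ₂) (p : ℝ) :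
    HasDerivAt (dispersion γ₁ γ₂) (Real.sqrt (γ₁ * γ₂) * Real.cos p *
      (radical γ₁ γ₂ p + radical γ₁ γ₂ (-p)) / (Real.sqrt 2 * Cfun γ₁ γ₂ (2 * p))) p := by
  have hneg := (hasDerivAt_radical hγ₁ hγ (-p)).comp p (hasDerivAt_neg p)
  refine (((hasDerivAt_radical hγ₁ hγ p).sub hneg).div_const (Real.sqrt 2)).congr_deriv ?_
  have h₁ := (radical_pos hγ₁ hγ p).ne'
  have h₂ := (radical_pos hγ₁ hγ (-p)).ne'
  rw [Cfun_two_mul hγ₁ hγ, Real.cos_neg]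
  field_simp
  ring

theorem deriv_dispersion_nonneg (hγ₁ : 0 < γ₁) (hγ : γ₁ < γ₂) {p : ℝ}
    (hp : p ∈ Icc (-(Real.pi / 2)) (Real.pi / 2)) : 0 ≤ deriv (dispersion γ₁ γ₂) p := by
  have hcos := Real.cos_nonneg_of_mem_Icc hp
  have h₁ := radical_pos hγ₁ hγ p
  have h₂ := radical_pos hγ₁ hγ (-p)
  rw [(hasDerivAt_dispersion hγ₁ hγ p).deriv, Cfun_two_mul hγ₁ hγ]
  positivity

theorem deriv_dispersion_zero (hγ₁ : 0 < γ₁) (hγ : γ₁ < γ₂) :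
    deriv (dispersion γ₁ γ₂) 0 = cVel γ₁ γ₂ := by
  have hγ₂ := hγ₁.trans hγ
  have hradical := radical_pos hγ₁ hγ 0
  rw [(hasDerivAt_dispersion hγ₁ hγ 0).deriv, Cfun_two_mul hγ₁ hγ, neg_zero, cVel, eq_comm,
    Real.sqrt_eq_iff_eq_sq (by positivity) (by rw [Real.cos_zero]; positivity)]
  have hsq : radical γ₁ γ₂ 0 ^ 2 = γ₁ + γ₂ := by simp [radical_sq hγ₁ hγ]
  rw [← hsq, Real.cos_zero]
  field_simp
  rw [Real.sq_sqrt (by positivity), Real.sq_sqrt (by positivity)]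
  ring

theorem cVel_pos (hγ₁ : 0 < γ₁) (hγ₂ : 0 < γ₂) : 0 < cVel γ₁ γ₂ :=
  Real.sqrt_pos.2 (by positivity)

theorem add_mul_cVel_sq (hγ₁ : 0 < γ₁) (hγ₂ : 0 < γ₂) :
    (γ₁ + γ₂) * cVel γ₁ γ₂ ^ 2 = 2 * γ₁ * γ₂ := by
  rw [cVel, Real.sq_sqrt (by positivity)]
  field_simp

theorem qDisp_pos (hγ₁ : 0 < γ₁) (hγ₂ : 0 < γ₂) : 0 < qDisp γ₁ γ₂ := by
  have hform : 0 < γ₁ ^ 2 - γ₁ * γ₂ + γ₂ ^ 2 := by nlinarith [sq_nonneg (γ₁ - γ₂)]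
  have := cVel_pos hγ₁ hγ₂
  unfold qDisp
  positivity

theorem deriv_dispersion_mul_Cfun_sq_le (hγ₁ : 0 < γ₁) (hγ : γ₁ < γ₂) (p : ℝ) :
    (deriv (dispersion γ₁ γ₂) p * Cfun γ₁ γ₂ (2 * p)) ^ 2 ≤
      cVel γ₁ γ₂ ^ 2 * (γ₁ + γ₂) ^ 2 * Real.cos p ^ 2 := by
  have hγ₂ := hγ₁.trans hγ
  have hC : 0 < Cfun γ₁ γ₂ (2 * p) :=
    Cfun_two_mul hγ₁ hγ p ▸ mul_pos (radical_pos hγ₁ hγ p) (radical_pos hγ₁ hγ (-p))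
  have hneg := radical_sq hγ₁ hγ (-p)
  rw [Real.sin_neg] at hneg
  have hadd : (radical γ₁ γ₂ p + radical γ₁ γ₂ (-p)) ^ 2 ≤ 4 * (γ₁ + γ₂) :=
    add_sq_le.trans_eq (by linear_combination 2 * (radical_sq hγ₁ hγ p + hneg))
  rw [(hasDerivAt_dispersion hγ₁ hγ p).deriv]
  calc _ = γ₁ * γ₂ / 2 * Real.cos p ^ 2 * (radical γ₁ γ₂ p + radical γ₁ γ₂ (-p)) ^ 2 := by
        rw [← div_div, div_mul_cancel₀ _ hC.ne', div_pow, mul_pow, mul_pow,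
          Real.sq_sqrt (by positivity), Real.sq_sqrt zero_le_two]
        ring
    _ ≤ γ₁ * γ₂ / 2 * Real.cos p ^ 2 * (4 * (γ₁ + γ₂)) := by gcongr
    _ = _ := by linear_combination (-(γ₁ + γ₂) * Real.cos p ^ 2) * add_mul_cVel_sq hγ₁ hγ₂

theorem deriv_dispersion_sq_le (hγ₁ : 0 < γ₁) (hγ : γ₁ < γ₂) (p : ℝ) :
    deriv (dispersion γ₁ γ₂) p ^ 2 ≤
      cVel γ₁ γ₂ ^ 2 * (1 - (γ₂ - γ₁) ^ 2 / (γ₁ + γ₂) ^ 2 * Real.sin p ^ 2) := by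
  have hγ₂ := hγ₁.trans hγ
  have hle := deriv_dispersion_mul_Cfun_sq_le hγ₁ hγ p
  have hC : 0 < Cfun γ₁ γ₂ (2 * p) ^ 2 := by
    rw [Cfun_two_mul hγ₁ hγ]
    exact pow_pos (mul_pos (radical_pos hγ₁ hγ p) (radical_pos hγ₁ hγ (-p))) 2
  have hCsq := radical_mul_radical_neg_sq hγ₁ hγ p
  rw [← Cfun_two_mul hγ₁ hγ] at hCsq
  rw [mul_pow, ← le_div_iff₀ hC] at hle
  refine hle.trans ?_
  rw [mul_assoc, mul_div_assoc]
  refine mul_le_mul_of_nonneg_left ?_ (sq_nonneg _)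
  rw [div_le_iff₀ hC, hCsq, Real.cos_sq']
  have hexcess : 0 ≤ (γ₂ - γ₁) ^ 2 / (γ₁ + γ₂) ^ 2 * 4 * (γ₁ * γ₂) * Real.sin p ^ 4 := by
    positivity
  have hratio : (γ₂ - γ₁) ^ 2 / (γ₁ + γ₂) ^ 2 * (γ₁ + γ₂) ^ 2 = (γ₂ - γ₁) ^ 2 := by field_simp
  linear_combination hexcess + Real.sin p ^ 2 * hratio

theorem mul_sin_sq_le_cVel_sub_deriv_dispersion (hγ₁ : 0 < γ₁) (hγ : γ₁ < γ₂) (p : ℝ) :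
    cVel γ₁ γ₂ * ((γ₂ - γ₁) ^ 2 / (γ₁ + γ₂) ^ 2 / 2) * Real.sin p ^ 2 ≤
      cVel γ₁ γ₂ - deriv (dispersion γ₁ γ₂) p := by
  have hc := cVel_pos hγ₁ (hγ₁.trans hγ)
  have hsq := deriv_dispersion_sq_le hγ₁ hγ p
  set δ := (γ₂ - γ₁) ^ 2 / (γ₁ + γ₂) ^ 2
  have hδ : 0 ≤ δ * Real.sin p ^ 2 := by positivity
  have hle : deriv (dispersion γ₁ γ₂) p ≤ cVel γ₁ γ₂ :=
    (abs_le_of_sq_le_sq' (hsq.trans (mul_le_of_le_one_right (by positivity) (by linarith)))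
      hc.le).2
  refine le_of_mul_le_mul_left ?_ hc
  nlinarith

theorem exists_mul_sq_le_cVel_sub_deriv_dispersion (hγ₁ : 0 < γ₁) (hγ : γ₁ < γ₂) :
    ∃ d : ℝ, 0 < d ∧ ∀ p, |p| ≤ Real.pi / 2 →
      d * p ^ 2 ≤ cVel γ₁ γ₂ - deriv (dispersion γ₁ γ₂) p := by
  have hc := cVel_pos hγ₁ (hγ₁.trans hγ)
  have hadd : 0 < γ₁ + γ₂ := by linarith
  have := sub_pos.2 hγ
  refine ⟨cVel γ₁ γ₂ * ((γ₂ - γ₁) ^ 2 / (γ₁ + γ₂) ^ 2 / 2) * (2 / Real.pi) ^ 2, by positivity,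
    fun p hp => le_trans ?_ (mul_sin_sq_le_cVel_sub_deriv_dispersion hγ₁ hγ p)⟩
  have hjordan : (2 / Real.pi) ^ 2 * p ^ 2 ≤ Real.sin p ^ 2 := by
    rw [← sq_abs p, ← sq_abs (Real.sin p), ← mul_pow]
    have := Real.mul_abs_le_abs_sin hp
    gcongr
  rw [mul_assoc _ ((2 / Real.pi) ^ 2)]
  gcongr

theorem contDiff_frontPhase (hγ₁ : 0 < γ₁) (hγ : γ₁ < γ₂) : ContDiff ℝ ∞ (frontPhase γ₁ γ₂) := by
  have hdispersion := contDiff_dispersion hγ₁ hγ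
  unfold frontPhase
  fun_prop

theorem frontPhase_odd : (frontPhase γ₁ γ₂).Odd := fun p => by
  rw [frontPhase, frontPhase, dispersion_odd]
  ring

theorem deriv_frontPhase (hγ₁ : 0 < γ₁) (hγ : γ₁ < γ₂) (p : ℝ) :
    deriv (frontPhase γ₁ γ₂) p =
      (cVel γ₁ γ₂ - deriv (dispersion γ₁ γ₂) p) / qDisp γ₁ γ₂ := by
  have hdispersion := ((contDiff_infty_iff_deriv.1 (contDiff_dispersion hγ₁ hγ)).1 p).hasDerivAt
  exact (((hasDerivAt_const_mul (cVel γ₁ γ₂)).sub hdispersion).div_const (qDisp γ₁ γ₂)).deriv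

-- Compare the coefficients of `p ^ 4` in `dispersion_quartic`, where
-- `dispersion p = c p - q p ^ 3 w(p)` and `sin p = p - p ^ 3 u(p)`.
theorem eq_one_third_of_frontPhase_eq_cube_mul (hγ₁ : 0 < γ₁) (hγ : γ₁ < γ₂) {w : ℝ → ℝ}
    (hw : Continuous w) (hψ : ∀ p, frontPhase γ₁ γ₂ p = p ^ 3 * w p) : w 0 = 1 / 3 := by
  have hγ₂ := hγ₁.trans hγ
  have hq := qDisp_pos hγ₁ hγ₂
  have hc := cVel_pos hγ₁ hγ₂
  have hc2 := add_mul_cVel_sq hγ₁ hγ₂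
  have hqc : 2 * (γ₁ + γ₂) ^ 2 * qDisp γ₁ γ₂ =
      cVel γ₁ γ₂ * (γ₁ ^ 2 - γ₁ * γ₂ + γ₂ ^ 2) := by
    rw [qDisp]; field_simp
  obtain ⟨u, hu, hu0, hsin⟩ := exists_sin_eq_sub_cube_mul
  have hdispersion : ∀ p, dispersion γ₁ γ₂ p =
      p * (cVel γ₁ γ₂ - p ^ 2 * (qDisp γ₁ γ₂ * w p)) := fun p => by
    have hp := hψ p
    rw [frontPhase, div_eq_iff hq.ne'] at hp
    linear_combination -hp
  generalize cVel γ₁ γ₂ = c at *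
  generalize qDisp γ₁ γ₂ = q at *
  have hcoeff := congrFun (eq_of_pow_mul_eq 4
    (f := fun p => 2 * (γ₁ + γ₂) * (-2 * c * (q * w p) + p ^ 2 * (q * w p) ^ 2)
      - (c - p ^ 2 * (q * w p)) ^ 4)
    (g := fun p => 4 * (γ₁ * γ₂) * (-2 * u p + p ^ 2 * u p ^ 2))
    (by fun_prop) (by fun_prop) fun p => by
      have hquartic := dispersion_quartic hγ₁ hγ p
      rw [hdispersion, hsin] at hquartic
      linear_combination hquartic - 2 * p ^ 2 * hc2) 0
  simp only [hu0] at hcoeff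
  have hprod : (4 * (γ₁ + γ₂) ^ 3 * c * q) * (w 0 - 1 / 3) = 0 := by
    linear_combination (-(γ₁ + γ₂) ^ 2) * hcoeff
      - ((γ₁ + γ₂) * c ^ 2 + 2 * γ₁ * γ₂) * hc2
      - (2 / 3) * (γ₁ + γ₂) * c * hqc
      - (2 / 3) * (γ₁ ^ 2 - γ₁ * γ₂ + γ₂ ^ 2) * hc2
  exact sub_eq_zero.1 ((mul_eq_zero.1 hprod).resolve_left (by positivity))

theorem exists_cubicPhase_frontPhase (hγ₁ : 0 < γ₁) (hγ : γ₁ < γ₂) :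
    ∃ (d : ℝ) (v e : ℝ → ℝ), CubicPhase (Real.pi / 2) d (frontPhase γ₁ γ₂) v ∧ ContDiff ℝ ∞ e ∧
      ∀ p, frontPhase γ₁ γ₂ p = p ^ 3 / 3 + p ^ 5 * e p := by
  have hq := qDisp_pos hγ₁ (hγ₁.trans hγ)
  obtain ⟨w, hw, heven, hψ⟩ := exists_even_eq_cube_mul (contDiff_frontPhase hγ₁ hγ)
    frontPhase_odd (by rw [deriv_frontPhase hγ₁ hγ, deriv_dispersion_zero hγ₁ hγ, sub_self,
      zero_div])
  obtain ⟨e, he, -, hwe⟩ := exists_even_eq_add_sq_mul hw heven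
  obtain ⟨v, hv, -, hψ''⟩ := exists_deriv_deriv_eq_mul hw hψ
  obtain ⟨d, hd, hle⟩ := exists_mul_sq_le_cVel_sub_deriv_dispersion hγ₁ hγ
  refine ⟨min 1 (d / qDisp γ₁ γ₂), v, e, ⟨by positivity, by positivity, min_le_left _ _,
    contDiff_frontPhase hγ₁ hγ, hv, hψ'', fun p hp => ?_⟩, he, fun p => ?_⟩
  · rw [deriv_frontPhase hγ₁ hγ]
    calc min 1 (d / qDisp γ₁ γ₂) * p ^ 2 ≤ d / qDisp γ₁ γ₂ * p ^ 2 := by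
          gcongr; exact min_le_right _ _
      _ = d * p ^ 2 / qDisp γ₁ γ₂ := div_mul_eq_mul_div _ _ _
      _ ≤ _ := by gcongr; exact hle p hp
  · rw [hψ p, hwe p, eq_one_third_of_frontPhase_eq_cube_mul hγ₁ hγ hw.continuous hψ]
    ring

end Dispersion

/-! ### The amplitude -/

/-- The Fourier series `∑ₖ W(xₖ) e^{-i xₖ p}` of the samples of `W` at the points `xₖ`. -/
def sampledFourier (W : SchwartzMap ℝ ℝ) (x : ℤ → ℝ) (p : ℝ) : ℂ :=
  ∑' k : ℤ, (W (x k) : ℂ) * Complex.exp (-Complex.I * x k * p)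

theorem iteratedDeriv_const_mul_cexp (A c : ℂ) (n : ℕ) :
    iteratedDeriv n (fun p : ℝ => A * Complex.exp (c * p)) =
      fun p : ℝ => A * c ^ n * Complex.exp (c * p) := by
  induction n with
  | zero => simp
  | succ n ih =>
    rw [iteratedDeriv_succ, ih]
    ext p
    refine (((Complex.ofRealCLM.hasDerivAt.const_mul c).cexp).const_mul (A * c ^ n)).deriv.trans ?_
    simp only [Complex.ofRealCLM_apply, Complex.ofReal_one]
    ring

theorem summable_abs_schwartz_mul_pow (W : SchwartzMap ℝ ℝ) {x : ℤ → ℝ}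
    (hx : ∀ k : ℤ, |(k : ℝ)| ≤ |x k|) (n : ℕ) : Summable fun k => |W (x k)| * |x k| ^ n := by
  obtain ⟨C, hC⟩ := W.decay' (n + 2) 0
  refine Summable.of_norm_bounded_eventually
    ((Real.summable_one_div_int_pow (p := 2).2 one_lt_two).mul_left C) ?_
  filter_upwards [(finite_singleton (0 : ℤ)).compl_mem_cofinite] with k hk
  have hk_sq : (0 : ℝ) < (k : ℝ) ^ 2 := by
    have : (k : ℝ) ≠ 0 := by exact_mod_cast hk
    positivity
  have hdecay := hC (x k)
  rw [norm_iteratedFDeriv_zero, Real.norm_eq_abs, pow_add, sq_abs] at hdecay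
  have hkx : (k : ℝ) ^ 2 ≤ x k ^ 2 := sq_le_sq.2 (hx k)
  rw [Real.norm_of_nonneg (by positivity), mul_one_div, le_div_iff₀ hk_sq]
  calc |W (x k)| * |x k| ^ n * (k : ℝ) ^ 2 ≤ |W (x k)| * |x k| ^ n * x k ^ 2 := by gcongr
    _ = |x k| ^ n * x k ^ 2 * |W (x k)| := by ring
    _ ≤ C := hdecay

theorem contDiff_sampledFourier (W : SchwartzMap ℝ ℝ) {x : ℤ → ℝ}
    (hx : ∀ k : ℤ, |(k : ℝ)| ≤ |x k|) : ContDiff ℝ ∞ (sampledFourier W x) := by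
  refine contDiff_tsum (𝕜 := ℝ) (N := ⊤) (v := fun n k => |W (x k)| * |x k| ^ n)
    (fun k => ?_) (fun n _ => summable_abs_schwartz_mul_pow W hx n) fun n k p _ => ?_
  · have : ContDiff ℝ ∞ (fun p : ℝ => (p : ℂ)) := Complex.ofRealCLM.contDiff
    fun_prop
  · have hexp : -Complex.I * x k * p = ((-(x k * p) : ℝ) : ℂ) * Complex.I := by push_cast; ring
    rw [norm_iteratedFDeriv_eq_norm_iteratedDeriv, iteratedDeriv_const_mul_cexp, norm_mul, hexp,
      Complex.norm_exp_ofReal_mul_I]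
    simp

theorem conj_sampledFourier (W : SchwartzMap ℝ ℝ) (x : ℤ → ℝ) (p : ℝ) :
    conj (sampledFourier W x p) = sampledFourier W x (-p) := by
  simp only [sampledFourier, Complex.conj_tsum]
  refine tsum_congr fun k => ?_
  rw [map_mul, Complex.conj_ofReal, ← Complex.exp_conj]
  simp

theorem tildeV_eq_sampledFourier (W : SchwartzMap ℝ ℝ) (p : ℝ) (j : Fin 2) :
    tildeV W p j = sampledFourier W (fun k => 2 * k + (j : ℕ)) p := by
  fin_cases j <;> refine tsum_congr fun k => ?_ <;> push_cast <;> ring_nf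

theorem abs_int_le_abs_two_mul_add_fin (k : ℤ) (j : Fin 2) :
    |(k : ℝ)| ≤ |2 * (k : ℝ) + (j : ℕ)| := by
  have : |k| ≤ |2 * k + (j : ℕ)| := by
    rcases abs_cases k with h | h <;> rcases abs_cases (2 * k + (j : ℕ)) with h' | h' <;> omega
  exact_mod_cast this

theorem contDiff_tildeV (W : SchwartzMap ℝ ℝ) (j : Fin 2) :
    ContDiff ℝ ∞ fun p => tildeV W p j := by
  simp only [tildeV_eq_sampledFourier]
  exact contDiff_sampledFourier W fun k => abs_int_le_abs_two_mul_add_fin k j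

theorem conj_tildeV (W : SchwartzMap ℝ ℝ) (p : ℝ) (j : Fin 2) :
    conj (tildeV W p j) = tildeV W (-p) j := by
  simp only [tildeV_eq_sampledFourier, conj_sampledFourier]

theorem deriv_zero_of_even {f : ℝ → ℝ} (hf : f.Even) : deriv f 0 = 0 := by
  have hneg := deriv_comp_neg f 0
  rw [show (fun p => f (-p)) = f from funext hf, neg_zero] at hneg
  linarith

/-- The amplitude `𝒜(p) Ṽ⁰(p)` of the acoustic integral. -/
def amplitude (γ₁ γ₂ : ℝ) (W : SchwartzMap ℝ ℝ) (j : Fin 2) (p : ℝ) : ℂ :=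
  ((matA γ₁ γ₂ p).map Complex.ofReal).mulVec (tildeV W p) j

section Amplitude

variable {γ₁ γ₂ : ℝ}

theorem contDiff_Gfun (hγ₁ : 0 < γ₁) (hγ : γ₁ < γ₂) :
    ContDiff ℝ ∞ (Gfun γ₁ γ₂) := by
  unfold Gfun Cfun
  refine contDiff_const.add (ContDiff.sqrt ?_ fun p => (Cfun_radicand_pos hγ₁ hγ _).ne')
  fun_prop

theorem Gfun_pos (hγ : γ₁ < γ₂) (p : ℝ) : 0 < Gfun γ₁ γ₂ p :=
  add_pos_of_pos_of_nonneg (sub_pos.2 hγ) (Real.sqrt_nonneg _)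

theorem Jfun_pos (hγ₁ : 0 < γ₁) (hγ : γ₁ < γ₂) (p : ℝ) : 0 < Jfun γ₁ γ₂ p := by
  have hG := Gfun_pos hγ (2 * p)
  have hγ₂ := hγ₁.trans hγ
  unfold Jfun
  positivity

theorem contDiff_matA (hγ₁ : 0 < γ₁) (hγ : γ₁ < γ₂) (j l : Fin 2) :
    ContDiff ℝ ∞ fun p => matA γ₁ γ₂ p j l := by
  have hG := contDiff_Gfun hγ₁ hγ
  have hJ : ContDiff ℝ ∞ fun p => (Jfun γ₁ γ₂ p)⁻¹ := by
    refine ContDiff.inv ?_ fun p => (Jfun_pos hγ₁ hγ p).ne'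
    unfold Jfun
    fun_prop
  simp only [matA, Matrix.smul_apply, smul_eq_mul, one_div]
  refine hJ.mul ?_
  fin_cases j <;> fin_cases l <;> dsimp <;> fun_prop

theorem matA_neg (p : ℝ) : matA γ₁ γ₂ (-p) = matA γ₁ γ₂ p := by
  simp only [matA, Jfun, Gfun, Cfun, mul_neg, Real.cos_neg]

variable (W : SchwartzMap ℝ ℝ) (j : Fin 2)

theorem amplitude_eq_sum (p : ℝ) :
    amplitude γ₁ γ₂ W j p = ∑ l, (matA γ₁ γ₂ p j l : ℂ) * tildeV W p l := by
  simp only [amplitude, Matrix.mulVec, dotProduct, Matrix.map_apply]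

theorem contDiff_amplitude (hγ₁ : 0 < γ₁) (hγ : γ₁ < γ₂) :
    ContDiff ℝ ∞ (amplitude γ₁ γ₂ W j) := by
  rw [funext (amplitude_eq_sum W j)]
  exact ContDiff.sum fun l _ =>
    (Complex.ofRealCLM.contDiff.comp (contDiff_matA hγ₁ hγ j l)).mul (contDiff_tildeV W l)

theorem conj_amplitude (p : ℝ) :
    conj (amplitude γ₁ γ₂ W j p) = amplitude γ₁ γ₂ W j (-p) := by
  simp only [amplitude_eq_sum, map_sum, map_mul, Complex.conj_ofReal, conj_tildeV, matA_neg]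

-- The matrix `𝒜` is even, so only `Ṽ⁰` is differentiated.
theorem deriv_amplitude_zero (hγ₁ : 0 < γ₁) (hγ : γ₁ < γ₂) :
    deriv (amplitude γ₁ γ₂ W j) 0 =
      ∑ l, (matA γ₁ γ₂ 0 j l : ℂ) * deriv (fun p => tildeV W p l) 0 := by
  rw [funext (amplitude_eq_sum W j)]
  refine (HasDerivAt.fun_sum fun l _ => ?_).deriv
  have hA := ((contDiff_infty_iff_deriv.1 (contDiff_matA hγ₁ hγ j l)).1 0).hasDerivAt
  rw [deriv_zero_of_even fun p => by rw [matA_neg]] at hA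
  have hV := ((contDiff_infty_iff_deriv.1 (contDiff_tildeV W l)).1 0).hasDerivAt
  exact (hA.ofReal_comp.fun_mul hV).congr_deriv (by simp)

end Amplitude

/-! ### Integrals without stationary points -/

theorem norm_integral_mul_deriv_le {u v u' v' : ℝ → ℂ} {a b A B : ℝ} (hab : a ≤ b)
    (hu : ∀ p ∈ Icc a b, HasDerivAt u (u' p) p) (hv : ∀ p ∈ Icc a b, HasDerivAt v (v' p) p)
    (hu' : ContinuousOn u' (Icc a b)) (hv' : ContinuousOn v' (Icc a b))
    (hA : ∀ p ∈ Icc a b, ‖u p‖ ≤ A) (hB : ∀ p ∈ Icc a b, ‖u' p‖ ≤ B)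
    (hv_le : ∀ p ∈ Icc a b, ‖v p‖ ≤ 1) :
    ‖∫ p in a..b, u p * v' p‖ ≤ 2 * A + B * (b - a) := by
  have hend : ∀ p ∈ Icc a b, ‖u p * v p‖ ≤ A := fun p hp => by
    rw [norm_mul]
    exact (mul_le_of_le_one_right (norm_nonneg _) (hv_le p hp)).trans (hA p hp)
  have hint : ‖∫ p in a..b, u' p * v p‖ ≤ B * (b - a) := by
    rw [← abs_of_nonneg (sub_nonneg.2 hab)]
    refine intervalIntegral.norm_integral_le_of_norm_le_const fun p hp => ?_
    have hp' : p ∈ Icc a b := Ioc_subset_Icc_self (uIoc_of_le hab ▸ hp)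
    rw [norm_mul]
    exact (mul_le_of_le_one_right (norm_nonneg _) (hv_le p hp')).trans (hB p hp')
  rw [← uIcc_of_le hab] at hu hv hu' hv'
  rw [intervalIntegral.integral_mul_deriv_eq_deriv_mul hu hv hu'.intervalIntegrable
    hv'.intervalIntegrable]
  have hb := hend b (right_mem_Icc.2 hab)
  have ha := hend a (left_mem_Icc.2 hab)
  have := norm_sub_le (u b * v b - u a * v a) (∫ p in a..b, u' p * v p)
  linarith [norm_sub_le (u b * v b) (u a * v a)]

theorem norm_quotient_rule_le {z z' : ℂ} {d d' m M₀ M₁ M₂ : ℝ} (hm : 0 < m) (hd : m ≤ d)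
    (hM₀ : ‖z‖ ≤ M₀) (hM₁ : ‖z'‖ ≤ M₁) (hM₂ : ‖d'‖ ≤ M₂) :
    ‖(z' * d - z * d') / (d : ℂ) ^ 2‖ ≤ M₁ / m + M₀ * M₂ / m ^ 2 := by
  have hd_pos := hm.trans_le hd
  have hM₀_nonneg := (norm_nonneg _).trans hM₀
  have hM₁_nonneg := (norm_nonneg _).trans hM₁
  have hM₂_nonneg := (norm_nonneg _).trans hM₂
  have hsplit : (z' * d - z * d') / (d : ℂ) ^ 2 = z' / d - z * d' / (d : ℂ) ^ 2 := by
    have : (d : ℂ) ≠ 0 := by exact_mod_cast hd_pos.ne'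
    field_simp
  calc _ ≤ ‖z' / d‖ + ‖z * d' / (d : ℂ) ^ 2‖ := hsplit ▸ norm_sub_le _ _
    _ = ‖z'‖ / d + ‖z‖ * ‖d'‖ / d ^ 2 := by
        simp only [norm_div, norm_mul, norm_pow, Complex.norm_of_nonneg hd_pos.le,
          Complex.norm_real]
    _ ≤ _ := by gcongr

-- Integrate `F e^{iφ} = -i (F / φ') (e^{iφ})'` by parts.
theorem norm_integral_mul_cexp_le {F : ℝ → ℂ} {φ : ℝ → ℝ} {a b m M₀ M₁ M₂ : ℝ} (hab : a ≤ b)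
    (hm : 0 < m) (hF : ContDiff ℝ 1 F) (hφ : Differentiable ℝ φ) (hφ' : ContDiff ℝ 1 (deriv φ))
    (hφ_ge : ∀ p ∈ Icc a b, m ≤ deriv φ p) (hM₀ : ∀ p ∈ Icc a b, ‖F p‖ ≤ M₀)
    (hM₁ : ∀ p ∈ Icc a b, ‖deriv F p‖ ≤ M₁) (hM₂ : ∀ p ∈ Icc a b, ‖deriv (deriv φ) p‖ ≤ M₂) :
    ‖∫ p in a..b, F p * Complex.exp (φ p * Complex.I)‖ ≤
      2 * (M₀ / m) + (M₁ / m + M₀ * M₂ / m ^ 2) * (b - a) := by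
  obtain ⟨hF_diff, _⟩ := contDiff_one_iff_deriv.1 hF
  obtain ⟨hφ'_diff, _⟩ := contDiff_one_iff_deriv.1 hφ'
  have hpos : ∀ p ∈ Icc a b, 0 < deriv φ p := fun p hp => hm.trans_le (hφ_ge p hp)
  have hne : ∀ p ∈ Icc a b, ((deriv φ p : ℝ) : ℂ) ≠ 0 := fun p hp =>
    Complex.ofReal_ne_zero.2 (hpos p hp).ne'
  have hM₀_nonneg := (norm_nonneg _).trans (hM₀ a (left_mem_Icc.2 hab))
  have hdiv : ∀ p ∈ Icc a b, -Complex.I * (F p / deriv φ p) *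
      (Complex.exp (φ p * Complex.I) * (deriv φ p * Complex.I)) =
        F p * Complex.exp (φ p * Complex.I) := fun p hp => by
    have := hne p hp
    field_simp
    rw [Complex.I_sq]
    ring
  rw [← intervalIntegral.integral_congr fun p hp => hdiv p (uIcc_of_le hab ▸ hp)]
  have hφc := hφ.continuous
  have hφ'c := hφ'.continuous
  have hFc := hF.continuous
  refine norm_integral_mul_deriv_le (v := fun p => Complex.exp (φ p * Complex.I))
    (u' := fun p => -Complex.I * ((deriv F p * deriv φ p - F p * deriv (deriv φ) p) /
      ((deriv φ p : ℝ) : ℂ) ^ 2)) hab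
    (fun p hp => ((hF_diff p).hasDerivAt.fun_div (hφ'_diff p).hasDerivAt.ofReal_comp
      (hne p hp)).const_mul _)
    (fun p _ => ((hφ p).hasDerivAt.ofReal_comp.mul_const Complex.I).cexp)
    (continuousOn_const.mul (ContinuousOn.div (by fun_prop) (by fun_prop)
      fun p hp => pow_ne_zero 2 (hne p hp))) (by fun_prop) (fun p hp => ?_) (fun p hp => ?_)
    (fun p _ => (Complex.norm_exp_ofReal_mul_I _).le)
  · rw [norm_mul, norm_neg, Complex.norm_I, one_mul, norm_div,
      Complex.norm_of_nonneg (hpos p hp).le]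
    exact div_le_div₀ hM₀_nonneg (hM₀ p hp) hm (hφ_ge p hp)
  · rw [norm_mul, norm_neg, Complex.norm_I, one_mul]
    exact norm_quotient_rule_le hm (hφ_ge p hp) (hM₀ p hp) (hM₁ p hp) (hM₂ p hp)

theorem exists_norm_integral_nonstationary_le {F : ℝ → ℂ} {Ω : ℝ → ℝ} {b c : ℝ}
    (hF : ContDiff ℝ 1 F) (hΩ : Differentiable ℝ Ω) (hΩ' : ContDiff ℝ 1 (deriv Ω)) (hb : 0 ≤ b)
    (hc : 0 < c) (hΩ_nonneg : ∀ p ∈ Icc 0 b, 0 ≤ deriv Ω p) :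
    ∃ C : ℝ, ∀ μ t x : ℝ, 0 < μ → 0 < t → c * t ≤ x →
      ‖∫ p in (0 : ℝ)..b, F p * Complex.exp (Complex.I / μ * (p * x + Ω p * t))‖ ≤ C * (μ / t) := by
  obtain ⟨M₀, hM₀⟩ := isCompact_Icc.exists_bound_of_continuousOn
    (hF.continuous.continuousOn (s := Icc 0 b))
  obtain ⟨M₁, hM₁⟩ := isCompact_Icc.exists_bound_of_continuousOn
    ((contDiff_one_iff_deriv.1 hF).2.continuousOn (s := Icc 0 b))
  obtain ⟨M₂, hM₂⟩ := isCompact_Icc.exists_bound_of_continuousOn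
    ((contDiff_one_iff_deriv.1 hΩ').2.continuousOn (s := Icc 0 b))
  refine ⟨2 * (M₀ / c) + (M₁ / c + M₀ * M₂ / c ^ 2) * b, fun μ t x hμ ht hx => ?_⟩
  set φ : ℝ → ℝ := fun p => (p * x + Ω p * t) / μ
  have hφ : ∀ p, HasDerivAt φ ((x + deriv Ω p * t) / μ) p := fun p =>
    ((hasDerivAt_mul_const x).add ((hΩ p).hasDerivAt.mul_const t)).div_const μ
  have hφ' : deriv φ = fun p => (x + deriv Ω p * t) / μ := funext fun p => (hφ p).deriv
  have hφ'' : ∀ p, deriv (deriv φ) p = deriv (deriv Ω) p * (t / μ) := fun p => by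
    rw [hφ', ← mul_div_assoc]
    exact ((((contDiff_one_iff_deriv.1 hΩ').1 p).hasDerivAt.mul_const t).const_add x
      |>.div_const μ).deriv
  have hexp : ∀ p : ℝ, Complex.I / μ * (p * x + Ω p * t) = φ p * Complex.I := fun p => by
    simp only [φ]
    push_cast
    ring
  simp only [hexp]
  refine (norm_integral_mul_cexp_le (m := c * t / μ) (M₂ := M₂ * (t / μ)) hb (by positivity) hF
    (fun p => (hφ p).differentiableAt) (by rw [hφ']; fun_prop) (fun p hp => ?_) hM₀ hM₁
    fun p hp => ?_).trans_eq ?_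
  · rw [(hφ p).deriv]
    have := mul_nonneg (hΩ_nonneg p hp) ht.le
    gcongr
    linarith
  · rw [hφ'', norm_mul, Real.norm_of_nonneg (by positivity : 0 ≤ t / μ)]
    have := hM₂ p hp
    gcongr
  · field_simp
    ring

/-! ### The scales of the front -/

theorem rpow_one_third_pow_three {x : ℝ} (hx : 0 ≤ x) : (x ^ (1 / 3 : ℝ)) ^ 3 = x := by
  rw [← Real.rpow_natCast, ← Real.rpow_mul hx]
  norm_num

theorem rpow_two_thirds_eq_sq {x : ℝ} (hx : 0 ≤ x) : x ^ (2 / 3 : ℝ) = (x ^ (1 / 3 : ℝ)) ^ 2 := by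
  rw [← Real.rpow_natCast, ← Real.rpow_mul hx]
  norm_num

section Amp

variable {γ₁ γ₂ μ t t₀ : ℝ}

theorem amp_pos (hγ₁ : 0 < γ₁) (hγ₂ : 0 < γ₂) (hμ : 0 < μ) (ht : 0 < t) : 0 < amp γ₁ γ₂ μ t :=
  Real.rpow_pos_of_pos (div_pos hμ (mul_pos (qDisp_pos hγ₁ hγ₂) ht)) _

theorem amp_pow_three (hγ₁ : 0 < γ₁) (hγ₂ : 0 < γ₂) (hμ : 0 < μ) (ht : 0 < t) :
    amp γ₁ γ₂ μ t ^ 3 = μ / (qDisp γ₁ γ₂ * t) :=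
  rpow_one_third_pow_three (div_pos hμ (mul_pos (qDisp_pos hγ₁ hγ₂) ht)).le

theorem amp_le_amp_one_mul (hγ₁ : 0 < γ₁) (hγ₂ : 0 < γ₂) (hμ : 0 < μ) (ht₀ : 0 < t₀)
    (ht : t₀ ≤ t) : amp γ₁ γ₂ μ t ≤ amp γ₁ γ₂ 1 t₀ * μ ^ (1 / 3 : ℝ) := by
  have hq := qDisp_pos hγ₁ hγ₂
  have := ht₀.trans_le ht
  rw [amp, amp, ← Real.mul_rpow (by positivity) hμ.le, one_div_mul_eq_div]
  gcongr

theorem div_rpow_mul_rpow_eq_amp_mul_div (hγ₁ : 0 < γ₁) (hγ₂ : 0 < γ₂) (hμ : 0 < μ) (ht : 0 < t)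
    (ξ : ℝ) :
    ξ / (μ ^ (2 / 3 : ℝ) * (qDisp γ₁ γ₂ * t) ^ (1 / 3 : ℝ)) = amp γ₁ γ₂ μ t * ξ / μ := by
  have hqt : 0 < qDisp γ₁ γ₂ * t := mul_pos (qDisp_pos hγ₁ hγ₂) ht
  have := Real.rpow_pos_of_pos hμ (1 / 3)
  have := Real.rpow_pos_of_pos hqt (1 / 3)
  have hm_cube := rpow_one_third_pow_three hμ.le
  rw [rpow_two_thirds_eq_sq hμ.le, amp, Real.div_rpow hμ.le hqt.le]
  field_simp
  rw [hm_cube]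

end Amp

/-- The parameters of an observation at time `t ≥ t₀` and at the signed distance `ξ` from a front,
within the `K μ ^ (2 / 3)`-vicinity of that front. The last two fields make `μ` so small that this
vicinity is thin and the front is resolved. -/
structure NearFront (γ₁ γ₂ K t₀ μ t ξ : ℝ) : Prop where
  μ_pos : 0 < μ
  t₀_pos : 0 < t₀
  t₀_le : t₀ ≤ t
  abs_le : |ξ| ≤ K * μ ^ (2 / 3 : ℝ)
  μ_le : μ ≤ qDisp γ₁ γ₂ * t₀
  thin : K * μ ^ (2 / 3 : ℝ) ≤ min (cVel γ₁ γ₂) (qDisp γ₁ γ₂) / 2 * t₀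

namespace NearFront

variable {γ₁ γ₂ K t₀ μ t ξ : ℝ}

theorem t_pos (h : NearFront γ₁ γ₂ K t₀ μ t ξ) : 0 < t :=
  h.t₀_pos.trans_le h.t₀_le

theorem amp_pos (hγ₁ : 0 < γ₁) (hγ₂ : 0 < γ₂) (h : NearFront γ₁ γ₂ K t₀ μ t ξ) :
    0 < amp γ₁ γ₂ μ t :=
  DiatomicLattice.amp_pos hγ₁ hγ₂ h.μ_pos h.t_pos

theorem amp_le_one (hγ₁ : 0 < γ₁) (hγ₂ : 0 < γ₂) (h : NearFront γ₁ γ₂ K t₀ μ t ξ) :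
    amp γ₁ γ₂ μ t ≤ 1 := by
  have hq := qDisp_pos hγ₁ hγ₂
  have hμ := h.μ_pos
  have ht := h.t_pos
  have hle := h.t₀_le
  refine Real.rpow_le_one (by positivity) ((div_le_one (by positivity)).2 ?_) (by norm_num)
  exact h.μ_le.trans (by gcongr)

theorem abs_amp_mul_div_le (hγ₁ : 0 < γ₁) (hγ₂ : 0 < γ₂) (h : NearFront γ₁ γ₂ K t₀ μ t ξ) :
    |amp γ₁ γ₂ μ t * ξ / μ| ≤ amp γ₁ γ₂ 1 t₀ * K := by
  have hμ := h.μ_pos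
  have := Real.rpow_pos_of_pos hμ (1 / 3)
  have hamp₁ := DiatomicLattice.amp_pos hγ₁ hγ₂ one_pos h.t₀_pos
  have hξ := h.abs_le
  rw [rpow_two_thirds_eq_sq hμ.le] at hξ
  rw [abs_div, abs_mul, abs_of_pos hμ, abs_of_pos (h.amp_pos hγ₁ hγ₂), div_le_iff₀ hμ]
  calc amp γ₁ γ₂ μ t * |ξ|
      ≤ amp γ₁ γ₂ 1 t₀ * μ ^ (1 / 3 : ℝ) * (K * (μ ^ (1 / 3 : ℝ)) ^ 2) :=
        mul_le_mul (amp_le_amp_one_mul hγ₁ hγ₂ hμ h.t₀_pos h.t₀_le) hξ (abs_nonneg _)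
          (by positivity)
    _ = amp γ₁ γ₂ 1 t₀ * K * (μ ^ (1 / 3 : ℝ)) ^ 3 := by ring
    _ = amp γ₁ γ₂ 1 t₀ * K * μ := by rw [rpow_one_third_pow_three hμ.le]

theorem div_le (hγ₁ : 0 < γ₁) (hγ₂ : 0 < γ₂) (h : NearFront γ₁ γ₂ K t₀ μ t ξ) :
    μ / t ≤ qDisp γ₁ γ₂ * amp γ₁ γ₂ 1 t₀ ^ 2 * μ ^ (2 / 3 : ℝ) * amp γ₁ γ₂ μ t := by
  have hq := qDisp_pos hγ₁ hγ₂
  have hμ := h.μ_pos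
  have hamp := h.amp_pos hγ₁ hγ₂
  have hle := amp_le_amp_one_mul hγ₁ hγ₂ hμ h.t₀_pos h.t₀_le
  calc μ / t = qDisp γ₁ γ₂ * amp γ₁ γ₂ μ t ^ 3 := by
        rw [amp_pow_three hγ₁ hγ₂ hμ h.t_pos]
        field_simp
    _ = qDisp γ₁ γ₂ * amp γ₁ γ₂ μ t ^ 2 * amp γ₁ γ₂ μ t := by ring
    _ ≤ qDisp γ₁ γ₂ * (amp γ₁ γ₂ 1 t₀ * μ ^ (1 / 3 : ℝ)) ^ 2 * amp γ₁ γ₂ μ t := by gcongr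
    _ = _ := by
        rw [rpow_two_thirds_eq_sq hμ.le]
        ring

theorem abs_neg_div_le (hγ₁ : 0 < γ₁) (hγ₂ : 0 < γ₂) (h : NearFront γ₁ γ₂ K t₀ μ t ξ) :
    |-(ξ / (qDisp γ₁ γ₂ * t))| ≤ K * μ ^ (2 / 3 : ℝ) / (qDisp γ₁ γ₂ * t₀) := by
  have hq := qDisp_pos hγ₁ hγ₂
  have ht₀ := h.t₀_pos
  have hξ := h.abs_le
  have hle := h.t₀_le
  rw [abs_neg, abs_div, abs_of_pos (mul_pos hq h.t_pos)]
  exact div_le_div₀ ((abs_nonneg _).trans hξ) hξ (by positivity) (by gcongr)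

theorem abs_neg_div_le_half (hγ₁ : 0 < γ₁) (hγ₂ : 0 < γ₂) (h : NearFront γ₁ γ₂ K t₀ μ t ξ) :
    |-(ξ / (qDisp γ₁ γ₂ * t))| ≤ 1 / 2 := by
  have ht₀ := h.t₀_pos
  refine (h.abs_neg_div_le hγ₁ hγ₂).trans ((div_le_iff₀ (mul_pos (qDisp_pos hγ₁ hγ₂) ht₀)).2 ?_)
  calc _ ≤ min (cVel γ₁ γ₂) (qDisp γ₁ γ₂) / 2 * t₀ := h.thin
    _ ≤ qDisp γ₁ γ₂ / 2 * t₀ := by gcongr; exact min_le_right _ _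
    _ = _ := by ring

theorem half_cVel_mul_le (hγ₁ : 0 < γ₁) (hγ₂ : 0 < γ₂) {x : ℝ}
    (h : NearFront γ₁ γ₂ K t₀ μ t (x - cVel γ₁ γ₂ * t)) : cVel γ₁ γ₂ / 2 * t ≤ x := by
  have hc := cVel_pos hγ₁ hγ₂
  have ht₀ := h.t₀_pos
  have hle := h.t₀_le
  have : min (cVel γ₁ γ₂) (qDisp γ₁ γ₂) / 2 * t₀ ≤ cVel γ₁ γ₂ / 2 * t := by
    gcongr
    exact min_le_left _ _
  linarith [(_root_.abs_le.1 (h.abs_le.trans h.thin)).1]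

end NearFront

theorem exists_nearFront {γ₁ γ₂ t₀ : ℝ} (hγ₁ : 0 < γ₁) (hγ₂ : 0 < γ₂) (K : ℝ) (ht₀ : 0 < t₀) :
    ∃ μ₀ : ℝ, 0 < μ₀ ∧ ∀ μ t ξ : ℝ, 0 < μ → μ ≤ μ₀ → t₀ ≤ t → |ξ| ≤ K * μ ^ (2 / 3 : ℝ) →
      NearFront γ₁ γ₂ K t₀ μ t ξ := by
  have hq := qDisp_pos hγ₁ hγ₂
  have hc := cVel_pos hγ₁ hγ₂
  have hlim : Tendsto (fun μ : ℝ => K * μ ^ (2 / 3 : ℝ)) (𝓝 0) (𝓝 0) := by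
    have := ((Real.continuous_rpow_const (q := 2 / 3) (by norm_num)).const_mul K).tendsto 0
    rwa [Real.zero_rpow (by norm_num), mul_zero] at this
  have hsmall : ∀ᶠ μ : ℝ in 𝓝 0, μ ≤ qDisp γ₁ γ₂ * t₀ ∧
      K * μ ^ (2 / 3 : ℝ) ≤ min (cVel γ₁ γ₂) (qDisp γ₁ γ₂) / 2 * t₀ :=
    (eventually_le_nhds (by positivity)).and (hlim.eventually_le_const (by positivity))
  obtain ⟨μ₀, hμ₀, hball⟩ := Metric.nhds_basis_closedBall.eventually_iff.1 hsmall
  refine ⟨μ₀, hμ₀, fun μ t ξ hμ hle ht hξ => ?_⟩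
  obtain ⟨hμ_le, hthin⟩ := hball (by rwa [mem_closedBall_zero_iff, Real.norm_of_nonneg hμ.le])
  exact ⟨hμ, ht₀, ht, hξ, hμ_le, hthin⟩

/-! ### The acoustic integral at a front -/

/-- The leading term `f₀ Ai(y) - i a f₁ Ai'(y)` of an oscillatory integral at a front, up to a
factor: `f₀` and `f₁` stand for the amplitude and its derivative at the degenerate stationary point,
`a` for the width of the Airy layer, `y` for the rescaled distance to the front. -/
def airyForm (a y : ℝ) (f₀ f₁ : ℂ) : ℂ :=
  f₀ * airyAi y - Complex.I * a * f₁ * airyAiDeriv y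

theorem airyForm_sub (a y : ℝ) (f₀ f₁ g₀ g₁ : ℂ) :
    airyForm a y (f₀ - g₀) (f₁ - g₁) = airyForm a y f₀ f₁ - airyForm a y g₀ g₁ := by
  unfold airyForm
  ring

theorem airyForm_sum {ι : Type*} (u : Finset ι) (a y : ℝ) (c f₀ f₁ : ι → ℂ) :
    airyForm a y (∑ l ∈ u, c l * f₀ l) (∑ l ∈ u, c l * f₁ l) =
      ∑ l ∈ u, c l * airyForm a y (f₀ l) (f₁ l) := by
  simp only [airyForm, Finset.mul_sum, Finset.sum_mul, ← Finset.sum_sub_distrib]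
  exact Finset.sum_congr rfl fun l _ => by ring

theorem norm_airyForm_le {a y B : ℝ} (ha : 0 ≤ a) (hAi : |airyAi y| ≤ B)
    (hAi' : |airyAiDeriv y| ≤ B) (f₀ f₁ : ℂ) : ‖airyForm a y f₀ f₁‖ ≤ B * (‖f₀‖ + a * ‖f₁‖) := by
  calc ‖airyForm a y f₀ f₁‖ ≤ ‖f₀‖ * |airyAi y| + a * ‖f₁‖ * |airyAiDeriv y| := by
        refine (norm_sub_le _ _).trans_eq ?_
        simp only [norm_mul, Complex.norm_I, Complex.norm_real, Real.norm_eq_abs, one_mul,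
          abs_of_nonneg ha]
    _ ≤ ‖f₀‖ * B + a * ‖f₁‖ * B := by gcongr
    _ = B * (‖f₀‖ + a * ‖f₁‖) := by ring

/-- The acoustic integral with an arbitrary scalar amplitude `F`. -/
def acousticIntegral (γ₁ γ₂ : ℝ) (F : ℝ → ℂ) (μ x t : ℝ) : ℂ :=
  (1 / (Real.pi : ℂ)) * ∫ p in (-(Real.pi / 2))..(Real.pi / 2),
    F p * Complex.exp (Complex.I / μ * (p * x + omega1 γ₁ γ₂ p * t))

theorem two_mul_re_integral_neg_half {f : ℝ → ℂ} (hf : Continuous f)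
    (hconj : ∀ p, conj (f p) = f (-p)) (L : ℝ) :
    2 * (∫ p in (-L)..0, f p).re = (∫ p in (-L)..L, f p).re := by
  have hright : ∫ p in (0 : ℝ)..L, f p = conj (∫ p in (-L)..0, f p) := by
    rw [← intervalIntegral.intervalIntegral_conj]
    simp only [hconj, intervalIntegral.integral_comp_neg, neg_zero, neg_neg]
  rw [← intervalIntegral.integral_add_adjacent_intervals (hf.intervalIntegrable (-L) 0)
    (hf.intervalIntegrable 0 L), hright, Complex.add_re, Complex.conj_re, two_mul]

section AcousticIntegral

variable {γ₁ γ₂ : ℝ}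

theorem acousticIntegral_neg (hγ₁ : 0 < γ₁) (hγ : γ₁ < γ₂) (F : ℝ → ℂ) (μ x t : ℝ) :
    acousticIntegral γ₁ γ₂ (fun p => F (-p)) μ (-x) t = acousticIntegral γ₁ γ₂ F μ x t := by
  unfold acousticIntegral
  congr 1
  have hreflect := intervalIntegral.integral_comp_neg (a := -(Real.pi / 2)) (b := Real.pi / 2)
    (fun p : ℝ => F p * Complex.exp (Complex.I / μ * (p * x + omega1 γ₁ γ₂ p * t)))
  rw [neg_neg] at hreflect
  rw [← hreflect]
  refine intervalIntegral.integral_congr fun p _ => ?_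
  simp only [omega1_eq_abs_dispersion hγ₁ hγ, dispersion_odd p, abs_neg, Complex.ofReal_neg,
    mul_neg, neg_mul]

theorem osc_frontPhase {μ t : ℝ} (hγ₁ : 0 < γ₁) (hγ₂ : 0 < γ₂) (hμ : 0 < μ) (ht : 0 < t)
    (x p : ℝ) :
    osc (frontPhase γ₁ γ₂)
        ⟨1, amp γ₁ γ₂ μ t, amp γ₁ γ₂ μ t * (x - cVel γ₁ γ₂ * t) / μ⟩ p =
      Complex.exp (Complex.I / μ * (p * x - dispersion γ₁ γ₂ p * t)) := by
  have hq := qDisp_pos hγ₁ hγ₂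
  have hamp := amp_pos hγ₁ hγ₂ hμ ht
  have hcube := amp_pow_three hγ₁ hγ₂ hμ ht
  set a := amp γ₁ γ₂ μ t
  have hphase : (a ^ 2 * (a * (x - cVel γ₁ γ₂ * t) / μ) * p + phase (frontPhase γ₁ γ₂) 1 p) /
      a ^ 3 = (p * x - dispersion γ₁ γ₂ p * t) / μ := by
    calc _ = (x - cVel γ₁ γ₂ * t) / μ * p + frontPhase γ₁ γ₂ p / a ^ 3 := by
          simp only [phase]
          field_simp
          ring
      _ = _ := by
          rw [hcube, frontPhase]
          field_simp
          ring
  rw [osc, hphase]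
  push_cast
  ring_nf

theorem acousticIntegral_eq_add (hγ₁ : 0 < γ₁) (hγ : γ₁ < γ₂) {F : ℝ → ℂ} (hF : Continuous F)
    (μ x t : ℝ) :
    acousticIntegral γ₁ γ₂ F μ x t = (1 / (Real.pi : ℂ)) *
      ((∫ p in (-(Real.pi / 2))..0,
          F p * Complex.exp (Complex.I / μ * (p * x - dispersion γ₁ γ₂ p * t))) +
        ∫ p in (0 : ℝ)..(Real.pi / 2),
          F p * Complex.exp (Complex.I / μ * (p * x + dispersion γ₁ γ₂ p * t))) := by
  have hπ := Real.pi_pos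
  have hω : Continuous (omega1 γ₁ γ₂) := by
    rw [funext (omega1_eq_abs_dispersion hγ₁ hγ)]
    exact (contDiff_dispersion hγ₁ hγ).continuous.abs
  have hcont : Continuous fun p : ℝ =>
      F p * Complex.exp (Complex.I / μ * (p * x + omega1 γ₁ γ₂ p * t)) := by fun_prop
  rw [acousticIntegral, ← intervalIntegral.integral_add_adjacent_intervals
    (hcont.intervalIntegrable (-(Real.pi / 2)) 0) (hcont.intervalIntegrable 0 (Real.pi / 2))]
  congr 2 <;> refine intervalIntegral.integral_congr fun p hp => ?_
  · rw [uIcc_of_le (by linarith)] at hp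
    simp only [omega1_of_nonpos hγ₁ hγ ⟨by linarith [hp.1], hp.2⟩, Complex.ofReal_neg, neg_mul,
      sub_eq_add_neg]
  · rw [uIcc_of_le (by positivity)] at hp
    simp only [omega1_of_nonneg hγ₁ hγ ⟨hp.1, by linarith [hp.2]⟩]

theorem re_acousticIntegral_eq {μ t : ℝ} (hγ₁ : 0 < γ₁) (hγ : γ₁ < γ₂) {F : ℝ → ℂ}
    (hF : Continuous F) (hconj : ∀ p, conj (F p) = F (-p)) (hμ : 0 < μ) (ht : 0 < t) (x : ℝ) :
    (acousticIntegral γ₁ γ₂ F μ x t).re =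
      (oscInt (Real.pi / 2) (frontPhase γ₁ γ₂) 0 0 F
        ⟨1, amp γ₁ γ₂ μ t, amp γ₁ γ₂ μ t * (x - cVel γ₁ γ₂ * t) / μ⟩).re / (2 * Real.pi) +
      (∫ p in (0 : ℝ)..(Real.pi / 2),
        F p * Complex.exp (Complex.I / μ * (p * x + dispersion γ₁ γ₂ p * t))).re / Real.pi := by
  have hΩ := (contDiff_dispersion hγ₁ hγ).continuous
  have hsymm := two_mul_re_integral_neg_half
    (f := fun p : ℝ => F p * Complex.exp (Complex.I / μ * (p * x - dispersion γ₁ γ₂ p * t)))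
    (by fun_prop) (fun p => by
      rw [map_mul, hconj, ← Complex.exp_conj, dispersion_odd]
      simp only [map_mul, map_div₀, map_sub, Complex.conj_I, Complex.conj_ofReal,
        Complex.ofReal_neg]
      ring_nf) (Real.pi / 2)
  simp only [oscInt, weight, pow_zero, one_mul, div_one,
    osc_frontPhase hγ₁ (hγ₁.trans hγ) hμ ht, ← hsymm]
  rw [acousticIntegral_eq_add hγ₁ hγ hF, ← Complex.ofReal_one, ← Complex.ofReal_div,
    Complex.re_ofReal_mul, Complex.add_re, mul_div_mul_left _ _ two_ne_zero]
  ring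

theorem exists_norm_oscInt_frontPhase_sub_airyForm_le (hγ₁ : 0 < γ₁) (hγ : γ₁ < γ₂) {F : ℝ → ℂ}
    (hF : ContDiff ℝ ∞ F) (K t₀ : ℝ) :
    ∃ C : ℝ, ∀ μ t ξ : ℝ, NearFront γ₁ γ₂ K t₀ μ t ξ →
      ‖oscInt (Real.pi / 2) (frontPhase γ₁ γ₂) 0 0 F
          ⟨1, amp γ₁ γ₂ μ t, amp γ₁ γ₂ μ t * ξ / μ⟩ -
        (2 * Real.pi * amp γ₁ γ₂ μ t : ℝ) *
          airyForm (amp γ₁ γ₂ μ t) (amp γ₁ γ₂ μ t * ξ / μ) (F 0) (deriv F 0)‖ ≤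
        C * (μ / t) := by
  have hγ₂ := hγ₁.trans hγ
  obtain ⟨d, v, e, hψ, he, hψe⟩ := exists_cubicPhase_frontPhase hγ₁ hγ
  obtain ⟨C, hC⟩ := hψ.exists_norm_oscInt_sub_airy_le he hψe hF (amp γ₁ γ₂ 1 t₀ * K)
  refine ⟨C / qDisp γ₁ γ₂, fun μ t ξ h => ?_⟩
  have hle := hC _ ⟨h.amp_pos hγ₁ hγ₂, h.amp_le_one hγ₁ hγ₂⟩ _ (h.abs_amp_mul_div_le hγ₁ hγ₂)
  rw [amp_pow_three hγ₁ hγ₂ h.μ_pos h.t_pos] at hle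
  convert hle using 1
  · congr 2
    rw [airyForm]
    push_cast
    ring
  · ring

theorem exists_norm_integral_dispersion_le (hγ₁ : 0 < γ₁) (hγ : γ₁ < γ₂) {F : ℝ → ℂ}
    (hF : ContDiff ℝ 1 F) (K t₀ : ℝ) :
    ∃ C : ℝ, ∀ μ t x : ℝ, NearFront γ₁ γ₂ K t₀ μ t (x - cVel γ₁ γ₂ * t) →
      ‖∫ p in (0 : ℝ)..(Real.pi / 2),
        F p * Complex.exp (Complex.I / μ * (p * x + dispersion γ₁ γ₂ p * t))‖ ≤ C * (μ / t) := by
  have hγ₂ := hγ₁.trans hγ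
  have hΩ := contDiff_dispersion hγ₁ hγ
  have hΩ_nonneg : ∀ p ∈ Icc 0 (Real.pi / 2), 0 ≤ deriv (dispersion γ₁ γ₂) p := fun p hp =>
    deriv_dispersion_nonneg hγ₁ hγ ⟨by linarith [hp.1, Real.pi_pos], hp.2⟩
  obtain ⟨C, hC⟩ := exists_norm_integral_nonstationary_le hF (hΩ.differentiable (by simp))
    ((contDiff_infty_iff_deriv.1 hΩ).2.of_le (by exact_mod_cast le_top)) (by positivity)
    (half_pos (cVel_pos hγ₁ hγ₂)) hΩ_nonneg
  exact ⟨C, fun μ t x h => hC μ t x h.μ_pos h.t_pos (h.half_cVel_mul_le hγ₁ hγ₂)⟩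

theorem exists_abs_re_acousticIntegral_sub_le (hγ₁ : 0 < γ₁) (hγ : γ₁ < γ₂) {F : ℝ → ℂ}
    (hF : ContDiff ℝ ∞ F) (hconj : ∀ p, conj (F p) = F (-p)) (K t₀ : ℝ) :
    ∃ C : ℝ, ∀ μ t x : ℝ, NearFront γ₁ γ₂ K t₀ μ t (x - cVel γ₁ γ₂ * t) →
      |(acousticIntegral γ₁ γ₂ F μ x t).re - amp γ₁ γ₂ μ t *
        (airyForm (amp γ₁ γ₂ μ t) (amp γ₁ γ₂ μ t * (x - cVel γ₁ γ₂ * t) / μ)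
          (F 0) (deriv F 0)).re| ≤ C * (μ / t) := by
  have hπ := Real.pi_pos
  obtain ⟨C₁, hC₁⟩ := exists_norm_oscInt_frontPhase_sub_airyForm_le hγ₁ hγ hF K t₀
  obtain ⟨C₂, hC₂⟩ := exists_norm_integral_dispersion_le hγ₁ hγ
    (hF.of_le (by exact_mod_cast le_top)) K t₀
  refine ⟨C₁ / (2 * Real.pi) + C₂ / Real.pi, fun μ t x h => ?_⟩
  have hosc := (Complex.abs_re_le_norm _).trans (hC₁ μ t _ h)
  have hrest := (Complex.abs_re_le_norm _).trans (hC₂ μ t x h)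
  rw [Complex.sub_re, Complex.re_ofReal_mul] at hosc
  rw [re_acousticIntegral_eq hγ₁ hγ hF.continuous hconj h.μ_pos h.t_pos]
  set a := amp γ₁ γ₂ μ t
  set A := (airyForm a (a * (x - cVel γ₁ γ₂ * t) / μ) (F 0) (deriv F 0)).re
  set U := (oscInt (Real.pi / 2) (frontPhase γ₁ γ₂) 0 0 F
    ⟨1, a, a * (x - cVel γ₁ γ₂ * t) / μ⟩).re
  generalize (∫ p in (0 : ℝ)..(Real.pi / 2), F p *
    Complex.exp (Complex.I / μ * (p * x + dispersion γ₁ γ₂ p * t))).re = N at hrest ⊢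
  calc |U / (2 * Real.pi) + N / Real.pi - a * A|
      = |(U - 2 * Real.pi * a * A) / (2 * Real.pi) + N / Real.pi| := by
        congr 1
        field_simp
        ring
    _ ≤ C₁ * (μ / t) / (2 * Real.pi) + C₂ * (μ / t) / Real.pi := by
        refine (abs_add_le _ _).trans ?_
        rw [abs_div, abs_div, abs_of_pos hπ, abs_of_pos (by positivity : 0 < 2 * Real.pi)]
        gcongr
    _ = (C₁ / (2 * Real.pi) + C₂ / Real.pi) * (μ / t) := by ring

end AcousticIntegral

/-! ### The profiles -/

theorem exists_norm_even_odd_parts_sub_le {f : ℝ → ℂ} (hf : ContDiff ℝ ∞ f) :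
    ∃ M : ℝ, ∀ h ∈ Icc (0 : ℝ) 1,
      ‖(f h + f (-h)) / 2 - f 0‖ ≤ M * h ^ 2 ∧
      (h ≠ 0 → ‖(f h - f (-h)) / (2 * (h : ℂ)) - deriv f 0‖ ≤ M * h) := by
  obtain ⟨g, hg, hfg⟩ := exists_contDiff_eq_add_smul hf
  obtain ⟨k, hk, hgk⟩ := exists_contDiff_eq_add_smul hg
  have hg₀ : g 0 = deriv f 0 :=
    eq_deriv_zero_of_eq_add_smul (hg.differentiable (by simp)).differentiableAt hfg
  have hTaylor : ∀ p : ℝ, f p = f 0 + p * deriv f 0 + (p : ℂ) ^ 2 * k p := fun p => by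
    rw [hfg p, hgk p, hg₀, Complex.real_smul, Complex.real_smul]
    ring
  obtain ⟨M, hM⟩ := (isCompact_Icc (a := (-1 : ℝ)) (b := 1)).exists_bound_of_continuousOn
    hk.continuous.continuousOn
  refine ⟨M, fun h ⟨h₀, h₁⟩ => ?_⟩
  have hhalf : ∀ w : ℂ, ‖w‖ ≤ ‖k h‖ + ‖k (-h)‖ → ‖w / 2‖ ≤ M := fun w hw => by
    have hpos := hM h ⟨by linarith, h₁⟩
    have hneg := hM (-h) ⟨by linarith, by linarith⟩
    rw [norm_div, Complex.norm_ofNat]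
    linarith
  constructor
  · have : (f h + f (-h)) / 2 - f 0 = (k h + k (-h)) / 2 * (h : ℂ) ^ 2 := by
      rw [hTaylor h, hTaylor (-h)]
      push_cast
      ring
    rw [this, norm_mul, norm_pow, Complex.norm_of_nonneg h₀]
    gcongr
    exact hhalf _ (norm_add_le _ _)
  · intro hne
    have : (f h - f (-h)) / (2 * (h : ℂ)) - deriv f 0 = (k h - k (-h)) / 2 * (h : ℂ) := by
      have : (h : ℂ) ≠ 0 := by exact_mod_cast hne
      rw [hTaylor h, hTaylor (-h)]
      push_cast
      field_simp
      ring
    rw [this, norm_mul, Complex.norm_of_nonneg h₀]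
    gcongr
    exact hhalf _ (norm_sub_le _ _)

theorem norm_threePoint_sub_le {f : ℝ → Fin 2 → ℂ} {j : Fin 2} {M r z : ℝ} (hr : r ≤ 1)
    (hf : ∀ u ∈ Icc (0 : ℝ) 1, ‖f u j - f 0 j‖ ≤ M * u ^ r) (hz : |z| ≤ 1 / 2) :
    ‖threePoint f z j - f 0 j‖ ≤ 5 * M * |z| ^ r := by
  have hM : 0 ≤ M := by simpa using (norm_nonneg _).trans (hf 1 (by norm_num))
  have hpow : 0 ≤ M * |z| ^ r := by positivity
  have hnear := hf |z| ⟨abs_nonneg z, by linarith⟩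
  have hfar := hf (2 * |z|) ⟨by positivity, by linarith⟩
  rcases le_or_gt 0 z with hz₀ | hz₀
  · rw [threePoint, if_pos hz₀]
    rw [abs_of_nonneg hz₀] at *
    linarith
  · rw [threePoint, if_neg hz₀.not_ge]
    rw [abs_of_neg hz₀] at *
    rw [Real.mul_rpow zero_le_two (by linarith), mul_neg, ← neg_mul] at hfar
    have htwo : M * ((2 : ℝ) ^ r * (-z) ^ r) ≤ M * (2 * (-z) ^ r) := by
      have : (2 : ℝ) ^ r ≤ 2 := by simpa using Real.rpow_le_rpow_of_exponent_le one_le_two hr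
      have := Real.rpow_nonneg (neg_nonneg.2 hz₀.le) r
      gcongr
    calc ‖3 * f 0 j - 3 * f (-z) j + f (-2 * z) j - f 0 j‖
        = ‖(f (-2 * z) j - f 0 j) - 3 * (f (-z) j - f 0 j)‖ := by ring_nf
      _ ≤ ‖f (-2 * z) j - f 0 j‖ + 3 * ‖f (-z) j - f 0 j‖ := by
          simpa using norm_sub_le (f (-2 * z) j - f 0 j) (3 * (f (-z) j - f 0 j))
      _ ≤ 5 * M * (-z) ^ r := by linarith

theorem exists_norm_tildeV_sub_le (W : SchwartzMap ℝ ℝ) (j : Fin 2) :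
    ∃ M : ℝ, 0 ≤ M ∧ ∀ z : ℝ, |z| ≤ 1 / 2 →
      ‖tildeV1 W z j - tildeV W 0 j‖ ≤ M * |z| ∧
      ‖tildeV2 W z j - deriv (fun p => tildeV W p j) 0‖ ≤ M * √|z| := by
  obtain ⟨M, hM⟩ := exists_norm_even_odd_parts_sub_le (contDiff_tildeV W j)
  have hM₀ : 0 ≤ M := by simpa using (norm_nonneg _).trans (hM 1 (by norm_num)).1
  have hsqrt : ∀ u ∈ Icc (0 : ℝ) 1, √u ∈ Icc (0 : ℝ) 1 := fun u hu =>
    ⟨Real.sqrt_nonneg u, Real.sqrt_le_one.2 hu.2⟩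
  have heven₀ : evenPart W 0 j = tildeV W 0 j := by simp [evenPart]
  have hodd₀ : oddPart W 0 j = deriv (fun p => tildeV W p j) 0 := by simp [oddPart]
  refine ⟨5 * M, by positivity, fun z hz => ⟨?_, ?_⟩⟩
  · rw [← heven₀, ← Real.rpow_one |z|]
    refine norm_threePoint_sub_le le_rfl (fun u hu => ?_) hz
    rw [Real.rpow_one, heven₀]
    exact (hM √u (hsqrt u hu)).1.trans_eq (by rw [Real.sq_sqrt hu.1])
  · rw [← hodd₀, Real.sqrt_eq_rpow]
    refine norm_threePoint_sub_le (by norm_num) (fun u hu => ?_) hz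
    rw [← Real.sqrt_eq_rpow, hodd₀]
    rcases hu.1.eq_or_lt with rfl | hu₀
    · simp [hodd₀]
    · rw [oddPart, if_neg hu₀.ne']
      exact (hM √u (hsqrt u hu)).2 (Real.sqrt_ne_zero'.2 hu₀)

/-- The profile at the front `x = s c t`, for `s = ±1`, in the variable `ξ = s x - c t`. The Airy
functions are evaluated at `a ξ / μ`, which equals `ξ / (μ ^ (2 / 3) (q t) ^ (1 / 3))`. -/
def frontProfile (γ₁ γ₂ : ℝ) (W : SchwartzMap ℝ ℝ) (s μ ξ t : ℝ) : Fin 2 → ℝ :=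
  let a := amp γ₁ γ₂ μ t
  let z := -(ξ / (qDisp γ₁ γ₂ * t))
  (matA γ₁ γ₂ 0).mulVec fun j =>
    (airyForm a (a * ξ / μ) (tildeV1 W z j) (s * tildeV2 W z j)).re

section FrontProfile

variable {γ₁ γ₂ : ℝ} (W : SchwartzMap ℝ ℝ)

theorem rightProfile_eq {μ t : ℝ} (hγ₁ : 0 < γ₁) (hγ₂ : 0 < γ₂) (hμ : 0 < μ) (ht : 0 < t)
    (x : ℝ) :
    rightProfile γ₁ γ₂ W μ x t = frontProfile γ₁ γ₂ W 1 μ (1 * x - cVel γ₁ γ₂ * t) t := by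
  simp only [rightProfile, frontProfile, airyForm, one_mul, Complex.ofReal_one,
    div_rpow_mul_rpow_eq_amp_mul_div hγ₁ hγ₂ hμ ht]

theorem leftProfile_eq {μ t : ℝ} (hγ₁ : 0 < γ₁) (hγ₂ : 0 < γ₂) (hμ : 0 < μ) (ht : 0 < t)
    (x : ℝ) :
    leftProfile γ₁ γ₂ W μ x t = frontProfile γ₁ γ₂ W (-1) μ (-1 * x - cVel γ₁ γ₂ * t) t := by
  rw [show -1 * x - cVel γ₁ γ₂ * t = -(x + cVel γ₁ γ₂ * t) by ring]
  simp only [leftProfile, frontProfile, airyForm, neg_div, neg_neg, mul_neg, neg_mul, one_mul,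
    Complex.ofReal_neg, Complex.ofReal_one, sub_neg_eq_add,
    div_rpow_mul_rpow_eq_amp_mul_div hγ₁ hγ₂ hμ ht]

theorem exists_norm_airyForm_tildeV_sub_le (hγ₁ : 0 < γ₁) (hγ₂ : 0 < γ₂) (K t₀ : ℝ) {s : ℝ}
    (hs : |s| = 1) (j : Fin 2) :
    ∃ C : ℝ, ∀ μ t ξ : ℝ, NearFront γ₁ γ₂ K t₀ μ t ξ →
      ‖airyForm (amp γ₁ γ₂ μ t) (amp γ₁ γ₂ μ t * ξ / μ) (tildeV W 0 j)
          (s * deriv (fun p => tildeV W p j) 0) -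
        airyForm (amp γ₁ γ₂ μ t) (amp γ₁ γ₂ μ t * ξ / μ)
          (tildeV1 W (-(ξ / (qDisp γ₁ γ₂ * t))) j)
          (s * tildeV2 W (-(ξ / (qDisp γ₁ γ₂ * t))) j)‖ ≤ C * μ ^ (2 / 3 : ℝ) := by
  obtain ⟨M, hM₀, hM⟩ := exists_norm_tildeV_sub_le W j
  obtain ⟨B, hB⟩ := exists_abs_airyAi_le (amp γ₁ γ₂ 1 t₀ * K)
  set Z := K / (qDisp γ₁ γ₂ * t₀)
  refine ⟨B * (M * (Z + amp γ₁ γ₂ 1 t₀ * √Z)), fun μ t ξ h => ?_⟩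
  have hamp := h.amp_pos hγ₁ hγ₂
  have hamp₁ := amp_pos hγ₁ hγ₂ one_pos h.t₀_pos
  obtain ⟨hAi, hAi'⟩ := hB _ (h.abs_amp_mul_div_le hγ₁ hγ₂)
  have hB₀ := (abs_nonneg _).trans hAi
  obtain ⟨hV₁, hV₂⟩ := hM _ (h.abs_neg_div_le_half hγ₁ hγ₂)
  have hroot := Real.rpow_nonneg h.μ_pos.le (1 / 3)
  have hz : |-(ξ / (qDisp γ₁ γ₂ * t))| ≤ Z * (μ ^ (1 / 3 : ℝ)) ^ 2 := by
    rw [← rpow_two_thirds_eq_sq h.μ_pos.le, div_mul_eq_mul_div]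
    exact h.abs_neg_div_le hγ₁ hγ₂
  have hsqrt := Real.sqrt_le_sqrt hz
  rw [Real.sqrt_mul' _ (sq_nonneg _), Real.sqrt_sq hroot] at hsqrt
  rw [← airyForm_sub, ← mul_sub]
  refine (norm_airyForm_le hamp.le hAi hAi' _ _).trans ?_
  rw [norm_mul, Complex.norm_real, Real.norm_eq_abs, hs, one_mul, norm_sub_rev,
    norm_sub_rev (deriv _ _), mul_assoc]
  gcongr
  calc _ ≤ M * (Z * (μ ^ (1 / 3 : ℝ)) ^ 2) +
        amp γ₁ γ₂ 1 t₀ * μ ^ (1 / 3 : ℝ) * (M * (√Z * μ ^ (1 / 3 : ℝ))) := by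
        gcongr
        · exact hV₁.trans (by gcongr)
        · exact amp_le_amp_one_mul hγ₁ hγ₂ h.μ_pos h.t₀_pos h.t₀_le
        · exact hV₂.trans (by gcongr)
    _ = _ := by
        rw [rpow_two_thirds_eq_sq h.μ_pos.le]
        ring

theorem re_airyForm_amplitude (hγ₁ : 0 < γ₁) (hγ : γ₁ < γ₂) (a y s : ℝ) (j : Fin 2) :
    (airyForm a y (amplitude γ₁ γ₂ W j 0) (s * deriv (amplitude γ₁ γ₂ W j) 0)).re =
      ∑ l, matA γ₁ γ₂ 0 j l *
        (airyForm a y (tildeV W 0 l) (s * deriv (fun p => tildeV W p l) 0)).re := by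
  rw [amplitude_eq_sum, deriv_amplitude_zero W j hγ₁ hγ, Finset.mul_sum]
  simp only [mul_left_comm (s : ℂ), airyForm_sum, Complex.re_sum, Complex.re_ofReal_mul]

theorem exists_abs_re_airyForm_amplitude_sub_le (hγ₁ : 0 < γ₁) (hγ : γ₁ < γ₂) (K t₀ : ℝ) {s : ℝ}
    (hs : |s| = 1) (j : Fin 2) :
    ∃ C : ℝ, ∀ μ t ξ : ℝ, NearFront γ₁ γ₂ K t₀ μ t ξ →
      |(airyForm (amp γ₁ γ₂ μ t) (amp γ₁ γ₂ μ t * ξ / μ) (amplitude γ₁ γ₂ W j 0)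
          (s * deriv (amplitude γ₁ γ₂ W j) 0)).re - frontProfile γ₁ γ₂ W s μ ξ t j| ≤
        C * μ ^ (2 / 3 : ℝ) := by
  choose C hC using exists_norm_airyForm_tildeV_sub_le W hγ₁ (hγ₁.trans hγ) K t₀ hs
  refine ⟨∑ l, |matA γ₁ γ₂ 0 j l| * C l, fun μ t ξ h => ?_⟩
  simp only [re_airyForm_amplitude W hγ₁ hγ, frontProfile, Matrix.mulVec, dotProduct,
    ← Finset.sum_sub_distrib, ← mul_sub, ← Complex.sub_re]
  rw [Finset.sum_mul]
  refine (Finset.abs_sum_le_sum_abs _ _).trans (Finset.sum_le_sum fun l _ => ?_)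
  rw [abs_mul, mul_assoc]
  gcongr
  exact (Complex.abs_re_le_norm _).trans (hC l μ t ξ h)

theorem Iac_eq_acousticIntegral {s : ℝ} (hγ₁ : 0 < γ₁) (hγ : γ₁ < γ₂) (hs : s = 1 ∨ s = -1)
    (j : Fin 2) (μ x t : ℝ) :
    Iac γ₁ γ₂ W μ x t j =
      acousticIntegral γ₁ γ₂ (fun p => amplitude γ₁ γ₂ W j (s * p)) μ (s * x) t := by
  rcases hs with rfl | rfl
  · simp only [one_mul]
    rfl
  · simp only [neg_one_mul]
    rw [acousticIntegral_neg hγ₁ hγ]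
    rfl

theorem exists_front_estimate (hγ₁ : 0 < γ₁) (hγ : γ₁ < γ₂) (K t₀ : ℝ) {s : ℝ}
    (hs : s = 1 ∨ s = -1) (j : Fin 2) :
    ∃ C : ℝ, ∀ μ t x : ℝ, NearFront γ₁ γ₂ K t₀ μ t (s * x - cVel γ₁ γ₂ * t) →
      |(Iac γ₁ γ₂ W μ x t j).re - amp γ₁ γ₂ μ t *
        frontProfile γ₁ γ₂ W s μ (s * x - cVel γ₁ γ₂ * t) t j| ≤
        C * μ ^ (2 / 3 : ℝ) * amp γ₁ γ₂ μ t := by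
  have hγ₂ := hγ₁.trans hγ
  have hs_abs : |s| = 1 := by rcases hs with rfl | rfl <;> simp
  obtain ⟨C₁, hC₁⟩ := exists_abs_re_acousticIntegral_sub_le hγ₁ hγ
    (F := fun p => amplitude γ₁ γ₂ W j (s * p))
    ((contDiff_amplitude W j hγ₁ hγ).comp (contDiff_const.mul contDiff_id))
    (fun p => by rw [conj_amplitude, mul_neg]) K t₀
  obtain ⟨C₂, hC₂⟩ := exists_abs_re_airyForm_amplitude_sub_le W hγ₁ hγ K t₀ hs_abs j
  refine ⟨|C₁| * (qDisp γ₁ γ₂ * amp γ₁ γ₂ 1 t₀ ^ 2) + C₂, fun μ t x h => ?_⟩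
  have hamp := h.amp_pos hγ₁ hγ₂
  have hint := hC₁ μ t (s * x) h
  rw [deriv_comp_mul_left, mul_zero, Complex.real_smul,
    ← Iac_eq_acousticIntegral W hγ₁ hγ hs] at hint
  have hprof := mul_le_mul_of_nonneg_left (hC₂ μ t _ h) hamp.le
  rw [← abs_of_pos hamp, ← abs_mul, abs_of_pos hamp, mul_sub] at hprof
  have hdiv : C₁ * (μ / t) ≤ |C₁| * (qDisp γ₁ γ₂ * amp γ₁ γ₂ 1 t₀ ^ 2 * μ ^ (2 / 3 : ℝ) *
      amp γ₁ γ₂ μ t) :=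
    mul_le_mul (le_abs_self C₁) (h.div_le hγ₁ hγ₂) (div_pos h.μ_pos h.t_pos).le (abs_nonneg C₁)
  linarith [abs_sub_le (Iac γ₁ γ₂ W μ x t j).re
    (amp γ₁ γ₂ μ t * (airyForm (amp γ₁ γ₂ μ t)
      (amp γ₁ γ₂ μ t * (s * x - cVel γ₁ γ₂ * t) / μ) (amplitude γ₁ γ₂ W j 0)
      (s * deriv (amplitude γ₁ γ₂ W j) 0)).re)
    (amp γ₁ γ₂ μ t * frontProfile γ₁ γ₂ W s μ (s * x - cVel γ₁ γ₂ * t) t j)]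

end FrontProfile

theorem LeadingOrder.of_abs_sub_le {C C' ε a P v : ℝ} (hC : C ≤ C') (hε : 0 ≤ ε) (ha : 0 < a)
    (h : |v - a * P| ≤ C * ε * a) : LeadingOrder C' ε a P v := by
  have h' : |v - a * P| ≤ C' * ε * a := h.trans (by gcongr)
  refine ⟨h', fun κ hκ hP => ⟨(v - a * P) / (a * P), ?_, ?_⟩⟩
  · have hP_pos : 0 < |P| := hκ.trans_le hP
    have hC'ε : 0 ≤ C' * ε := nonneg_of_mul_nonneg_left ((abs_nonneg _).trans h') ha
    rw [abs_div, abs_mul, abs_of_pos ha, div_le_iff₀ (by positivity)]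
    calc |v - a * P| ≤ C' * ε * a := h'
      _ = C' * ε / κ * (a * κ) := by field_simp
      _ ≤ C' * ε / κ * (a * |P|) := by gcongr
      _ = C' / κ * ε * (a * |P|) := by ring
  · have hP_ne : P ≠ 0 := abs_pos.1 (hκ.trans_le hP)
    field_simp
    ring

end DiatomicLattice

end

open DiatomicLattice

theorem mainTheorem8 (γ₁ γ₂ : ℝ) (hγ₁ : 0 < γ₁) (hγ : γ₁ < γ₂) (W : SchwartzMap ℝ ℝ)
    (K t₀ : ℝ) (hK : 0 < K) (ht₀ : 0 < t₀) :
    ∃ C : ℝ, 0 < C ∧ ∃ μ₀ : ℝ, 0 < μ₀ ∧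
      ∀ μ t x : ℝ, 0 < μ → μ ≤ μ₀ → t₀ ≤ t →
        (|x - DiatomicLattice.cVel γ₁ γ₂ * t| ≤ K * μ ^ (2 / 3 : ℝ) →
          ∀ j : Fin 2,
            DiatomicLattice.LeadingOrder C (μ ^ (2 / 3 : ℝ)) (DiatomicLattice.amp γ₁ γ₂ μ t)
              (DiatomicLattice.rightProfile γ₁ γ₂ W μ x t j)
              (DiatomicLattice.Iac γ₁ γ₂ W μ x t j).re) ∧
        (|x + DiatomicLattice.cVel γ₁ γ₂ * t| ≤ K * μ ^ (2 / 3 : ℝ) →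
          ∀ j : Fin 2,
            DiatomicLattice.LeadingOrder C (μ ^ (2 / 3 : ℝ)) (DiatomicLattice.amp γ₁ γ₂ μ t)
              (DiatomicLattice.leftProfile γ₁ γ₂ W μ x t j)
              (DiatomicLattice.Iac γ₁ γ₂ W μ x t j).re) := by
  have hγ₂ := hγ₁.trans hγ
  choose C₁ hC₁ using exists_front_estimate W hγ₁ hγ K t₀ (s := 1) (Or.inl rfl)
  choose C₂ hC₂ using exists_front_estimate W hγ₁ hγ K t₀ (s := -1) (Or.inr rfl)
  obtain ⟨C, hC⟩ := Finite.exists_le fun j => max (C₁ j) (C₂ j)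
  obtain ⟨μ₀, hμ₀, hnear⟩ := exists_nearFront hγ₁ hγ₂ K ht₀
  refine ⟨max 1 C, by positivity, μ₀, hμ₀, fun μ t x hμ hμ_le ht => ?_⟩
  have hε : 0 ≤ μ ^ (2 / 3 : ℝ) := Real.rpow_nonneg hμ.le _
  have ht_pos := ht₀.trans_le ht
  have hamp := amp_pos hγ₁ hγ₂ hμ ht_pos
  refine ⟨fun hx j => ?_, fun hx j => ?_⟩
  · rw [rightProfile_eq W hγ₁ hγ₂ hμ ht_pos]
    refine LeadingOrder.of_abs_sub_le ?_ hε hamp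
      (hC₁ j μ t x (hnear μ t _ hμ hμ_le ht (by rwa [one_mul])))
    exact (le_max_left _ _).trans ((hC j).trans (le_max_right _ _))
  · rw [leftProfile_eq W hγ₁ hγ₂ hμ ht_pos]
    refine LeadingOrder.of_abs_sub_le ?_ hε hamp (hC₂ j μ t x (hnear μ t _ hμ hμ_le ht ?_))
    · exact (le_max_right _ _).trans ((hC j).trans (le_max_right _ _))
    · rwa [neg_one_mul, ← neg_add', abs_neg]
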